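/- Let $d\ge 2$ and let $G=(V,L)$ be the Cayley tree in which every vertex has exactly $d+1$ neighbours; $\vec L$ denotes its set of oriented edges. Let $Q:\mathbb Z\to(0,\infty)$ be a transfer operator, i.e. $Q(-i)=Q(i)$ for all $i$ and $\sum_{i}Q(i)<\infty$. A boundary law for $Q$ is a function $\lambda:\mathbb Z\to(0,\infty)$ for which there is $c>0$ such that $$\lambda(i)=c\Big(\sum_{j\in\mathbb Z}Q(i-j)\lambda(j)\Big)^d\qquad(i\in\mathbb Z),$$ with convergent sums; it is $q$-periodic if $\lambda(i+q)=\lambda(i)$ for all $i$ ($q$ need not be the minimal period), and is then regarded as a function on $\mathbb Z_q=\mathbb Z/q\mathbb Z$. For a $q$-periodic boundary law $\lambda$ put, for $\bar i,\bar j,\bar s\in\mathbb Z_q$ and $j\in\mathbb Z$, $$Q_q(\bar s)=\sum_{l\in\bar s}Q(l),\qquad P'_q(\bar i,\bar j)=\frac{Q_q(\bar i-\bar j)\lambda(\bar j)}{\sum_{\bar s}Q_q(\bar i-\bar s)\lambda(\bar s)},\qquad \alpha(\bar i)=\frac{\lambda(\bar i)^{(d+1)/d}}{\sum_{\bar s}\lambda(\bar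 s)^{(d+1)/d}},\qquad \rho_q(j\mid\bar s)=\mathbf 1_{\{j\in\bar s\}}\frac{Q(j)}{Q_q(\bar s)}.$$ The associated gradient Gibbs measure $\nu^{\lambda}$ is the probability measure on $\mathbb Z^{\vec L}$, concentrated on configurations $\eta$ with $\eta_{(x,y)}=-\eta_{(y,x)}$ (where $\eta_{(x,y)}$ is the height at $y$ minus the height at $x$), such that for every finite connected $\Lambda\subset V$, every $w\in\Lambda$ and every $\zeta\in\mathbb Z^{\vec L}$, $$\nu^{\lambda}\big(\eta_e=\zeta_e\ \text{for all } e\in\vec L_{\Lambda,w}\big)=\sum_{\sigma'\in\mathbb Z_q^{\Lambda}}\alpha(\sigma'_w)\prod_{(x,y)\in\vec L_{\Lambda,w}}P'_q(\sigma'_x,\sigma'_y)\,\rho_q\big(\zeta_{(x,y)}\mid\sigma'_y-\sigma'_x\big),$$ where $\vec L_{\Lambda,w}$ is the set of oriented edges with both end points in $\Lambda$ that point away from $w$. Let $q\ge2$, let $\lambda_q$ be a $q$-periodic boundary law for $Q$, and let $p$ be the minimal period of $\lambda_q$. Then $\nu^{\lambda_q}$ exists, is unique, and the following holds. For $\tilde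 q\geq 2$ let $\Delta^{\tilde q}\subset\mathbb R^{\tilde q}$ be the standard simplex, with coordinates indexed by $\mathbb Z_{\tilde q}$, and call $u,v\in\Delta^{\tilde q}$ equivalent, $u\sim v$, if $u=v(\cdot+s)$ for some $s\in\mathbb Z_{\tilde q}$. 1. For every $\tilde q\in\{2,3,\ldots\}$ there is a deterministic $\alpha_{\tilde q}\in\Delta^{\tilde q}$ such that, for every infinite self-avoiding path $x_0,x_1,\ldots$ in the tree and for the height field $(\sigma_{x_n})_{n\ge0}$ obtained from the increments $\eta$ along the path by prescribing a fixed height $h\in\mathbb Z$ at some vertex $x_m$, $\nu^{\lambda_q}$-almost surely the empirical distributions $$\Big(\frac1{n+1}\,\big|\{0\le i\le n:\ \sigma_{x_i}\equiv k \bmod \tilde q\}\big|\Big)_{k\in\mathbb Z_{\tilde q}}$$ converge as $n\to\infty$ to a (possibly random) element of $\Delta^{\tilde q}$ equivalent to $\alpha_{\tilde q}$; i.e. the limit is deterministic in $\Delta^{\tilde q}/\!\sim$. 2. For every such path, $m$ and $h$, and every choice of representatives $\alpha_{\tilde q}$ of these limits, $p$ is the greatest common divisor of all $\tilde q\in\{2,3,\ldots\}$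 with the property that the tentative boundary law $\tilde\lambda_{\tilde q}=\big(\alpha_{\tilde q}(0)^{\frac d{d+1}},\ldots,\alpha_{\tilde q}(\tilde q-1)^{\frac d{d+1}}\big)$ is indeed a $\tilde q$-periodic boundary law for $Q$ and $\nu^{\tilde\lambda_{\tilde q}}=\nu^{\lambda_q}$. -/

import Mathlib

open Filter Topology MeasureTheory

noncomputable section

namespace PeriodicGGM

/-! ### Transfer operators and height-periodic boundary laws -/

/-- A strictly positive, symmetric, summable (gradient) transfer operator on `ℤ`; the interaction
along an edge `{x, y}` is `Q (ω x - ω y)`. -/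
structure IsTransferOperator (Q : ℤ → ℝ) : Prop where
  pos : ∀ i, 0 < Q i
  symm : ∀ i, Q (-i) = Q i
  summable : Summable Q

/-- `lam` is a spatially homogeneous boundary law in `(0, ∞) ^ ℤ` for `Q` on the tree all of whose
vertices have `d + 1` neighbours: `lam i = c * (∑ j, Q (i - j) * lam j) ^ d` for some `c > 0`. -/
def IsBoundaryLaw (d : ℕ) (Q lam : ℤ → ℝ) : Prop :=
  (∀ i, 0 < lam i) ∧ (∀ i, Summable fun j : ℤ => Q (i - j) * lam j) ∧
    ∃ c : ℝ, 0 < c ∧ ∀ i, lam i = c * (∑' j : ℤ, Q (i - j) * lam j) ^ d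

/-- A `q`-height-periodic boundary law. A `q`-periodic function on `ℤ` is given by
a function on the residue classes mod `q`. The number `q` need not be the minimal period. -/
def IsPeriodicBoundaryLaw (d : ℕ) (Q : ℤ → ℝ) (q : ℕ) (lam : ZMod q → ℝ) : Prop :=
  IsBoundaryLaw d Q fun i : ℤ => lam (i : ZMod q)

/-- `p` is the minimal period of the function `f` on `ℤ`. -/
def IsMinimalPeriod (f : ℤ → ℝ) (p : ℕ) : Prop :=
  IsLeast {n : ℕ | 0 < n ∧ Function.Periodic f (n : ℤ)} p

/-! ### The fuzzy chain -/

/-- The fuzzy transfer operator `Q_q (s) = ∑_{l ∈ s} Q l`. -/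
def fuzzyQ (Q : ℤ → ℝ) (q : ℕ) (s : ZMod q) : ℝ :=
  ∑' l : ℤ, if (l : ZMod q) = s then Q l else 0

/-- The transition matrix `P'_q` of the fuzzy chain. -/
def fuzzyP (Q : ℤ → ℝ) (q : ℕ) [NeZero q] (lam : ZMod q → ℝ) (i j : ZMod q) : ℝ :=
  fuzzyQ Q q (i - j) * lam j / ∑ s : ZMod q, fuzzyQ Q q (i - s) * lam s

/-- The stationary distribution of the fuzzy chain, proportional to `lam ^ ((d + 1) / d)`. -/
def fuzzyAlpha (d q : ℕ) [NeZero q] (lam : ZMod q → ℝ) (i : ZMod q) : ℝ :=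
  lam i ^ (((d : ℝ) + 1) / d) / ∑ s : ZMod q, lam s ^ (((d : ℝ) + 1) / d)

/-- The conditional law `ρ (j ∣ s)` of an integer increment `j` given the fuzzy increment `s`. -/
def rho (Q : ℤ → ℝ) (q : ℕ) (j : ℤ) (s : ZMod q) : ℝ :=
  if (j : ZMod q) = s then Q j / fuzzyQ Q q s else 0

/-! ### The gradient measure on the tree -/

variable {V : Type*} (G : SimpleGraph V)

/-- An oriented edge with both end points in `L`, as an oriented edge of the whole graph. -/
def inclDart (L : Finset V) (e : (G.induce (L : Set V)).Dart) : G.Dart :=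
  ⟨(e.fst.1, e.snd.1), e.adj⟩

open Classical in
/-- The oriented edges with both end points in `L` that point away from `w`. If `G` is a tree,
every edge inside `L` occurs in exactly one of its two orientations. -/
def outwardDarts (L : Finset V) (w : V) : Finset (G.induce (L : Set V)).Dart :=
  Finset.univ.filter fun e => G.dist w e.snd.1 = G.dist w e.fst.1 + 1

open Classical in
/-- The probability that the two-layer construction gives to the increments `zeta` in the finite
volume `L` containing `w`: the fuzzy chain starts at `w` in its stationary distribution and moves
away from `w` with transition matrix `fuzzyP`; conditionally on it the integer increments along
the edges are independent with laws `rho`. -/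
def ggmWeight (d : ℕ) (Q : ℤ → ℝ) (q : ℕ) [NeZero q] (lam : ZMod q → ℝ)
    (L : Finset V) (w : V) (hw : w ∈ L) (zeta : G.Dart → ℤ) : ℝ :=
  ∑ s : (↥(L : Set V) → ZMod q),
    fuzzyAlpha d q lam (s ⟨w, hw⟩) *
      (∏ e ∈ outwardDarts G L w, fuzzyP Q q lam (s e.fst) (s e.snd)) *
      ∏ e ∈ outwardDarts G L w, rho Q q (zeta (inclDart G L e)) (s e.snd - s e.fst)

/-- `nu` is the gradient measure associated with the `q`-periodic boundary law `lam`: a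
probability measure on gradient configurations `η` (where `η (x, y) = - η (y, x)` stands for
`σ y - σ x`) with the finite-volume marginals of the two-layer construction. -/
structure IsGGM (d : ℕ) (Q : ℤ → ℝ) (q : ℕ) [NeZero q] (lam : ZMod q → ℝ)
    (nu : Measure (G.Dart → ℤ)) : Prop where
  prob : IsProbabilityMeasure nu
  antisymm : ∀ᵐ eta ∂nu, ∀ e : G.Dart, eta e.symm = -eta e
  marginal : ∀ (L : Finset V) (w : V) (hw : w ∈ L), (G.induce (L : Set V)).Connected →
    ∀ zeta : G.Dart → ℤ,
      nu {eta | ∀ e ∈ outwardDarts G L w, eta (inclDart G L e) = zeta (inclDart G L e)} =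
        ENNReal.ofReal (ggmWeight G d Q q lam L w hw zeta)

/-! ### Heights along an infinite path and their empirical distributions -/

/-- An infinite (self-avoiding) path `x 0, x 1, …` in the graph. -/
structure InfinitePath where
  vert : ℕ → V
  adj : ∀ n, G.Adj (vert n) (vert (n + 1))
  inj : Function.Injective vert

variable {G}

/-- The increment of the gradient configuration along the `n`-th edge of the path. -/
def InfinitePath.increment (x : InfinitePath G) (eta : G.Dart → ℤ) (n : ℕ) : ℤ :=
  eta ⟨(x.vert n, x.vert (n + 1)), x.adj n⟩

/-- The height at the `n`-th vertex of the path, if the height at its `m`-th vertex is `h`. -/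
def InfinitePath.height (x : InfinitePath G) (m : ℕ) (h : ℤ) (eta : G.Dart → ℤ) (n : ℕ) : ℤ :=
  h + (∑ k ∈ Finset.range n, x.increment eta k) - ∑ k ∈ Finset.range m, x.increment eta k

/-- The empirical distribution of `a 0, …, a n` mod `r`. -/
def empirical (r : ℕ) (a : ℕ → ℤ) (n : ℕ) (k : ZMod r) : ℝ :=
  (((Finset.range (n + 1)).filter fun i => (a i : ZMod r) = k).card : ℝ) / ((n : ℝ) + 1)

/-- Equality of `u` and `v` up to a cyclic permutation of the coordinates. -/
def CyclicEquiv {r : ℕ} (u v : ZMod r → ℝ) : Prop :=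
  ∃ s : ZMod r, ∀ k, u k = v (k + s)

/-- Almost surely the empirical distribution of the heights mod `r` along the path converges, and
its limit represents the class of the (deterministic) point `alpha` of the standard simplex,
modulo cyclic permutations of the coordinates. -/
def IsEmpiricalLimit (nu : Measure (G.Dart → ℤ)) (x : InfinitePath G) (m : ℕ) (h : ℤ)
    (r : ℕ) [NeZero r] (alpha : ZMod r → ℝ) : Prop :=
  alpha ∈ stdSimplex ℝ (ZMod r) ∧
    ∀ᵐ eta ∂nu, ∃ a : ZMod r → ℝ, CyclicEquiv a alpha ∧
      Tendsto (fun n : ℕ => empirical r (x.height m h eta) n) atTop (𝓝 a)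

/-- The tentative boundary law `alpha ^ (d / (d + 1))`. -/
def tentative (d : ℕ) {r : ℕ} (alpha : ZMod r → ℝ) (k : ZMod r) : ℝ :=
  alpha k ^ ((d : ℝ) / ((d : ℝ) + 1))

/-- `p` is the greatest common divisor of the elements of the set `S` of natural numbers. -/
def IsGCD (S : Set ℕ) (p : ℕ) : Prop :=
  IsGreatest {n : ℕ | ∀ r ∈ S, n ∣ r} p

end PeriodicGGM

end

noncomputable section

namespace PeriodicGGM

open ProbabilityTheory

set_option linter.unusedSectionVars false

section MarkovChain

/-! ### A strong law for bounded orthogonal sequences -/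

/-! Combining the fuzzy transition with the conditional increment law gives a chain on residue
classes with integer steps: from class `i` the step `z` has probability proportional to `Q z * lam
(i + z)`. The boundary law equation says that `fuzzyAlpha` is proportional to `lam * stepNorm`,
which is detailed balance (`fuzzyAlpha_mul_stepWeight`). Reversibility makes the finite-volume
weights independent of the root (`gradWeight_root_change`). Hence the measure built from independent
innovations at one root has all the required marginals (`isGGM_rootedGGM`), and these determine it
(`measure_ext_of_heightEvent`).

Along a self-avoiding path the heights modulo a period `N` form this finite chain, in which every
class is reachable in one step. Solving the Poisson equation reduces the law of large numbers to
bounded orthogonal martingale differences, so the empirical distribution tends to `fuzzyAlpha`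
translated by a random class (`isEmpiricalLimit_fuzzyAlpha`). For an arbitrary modulus `r`, the law
is regarded as `q * r`-periodic and the limit is projected to `ZMod r`.

Shifting or rescaling a boundary law, or regarding it at another period, changes neither the
boundary law property nor the gradient measure. If `p ∣ r`, the tentative law inverts the power in
`fuzzyAlpha` and so returns `lam` up to shift and scale: every multiple of `p` that is at least 2 is
admissible. Conversely, if `r` is admissible, comparing both laws modulo `q * r` shows that `lam`
has period `r` (`periodic_of_isGGM`), so `p ∣ r`. Since `2 * p` and `3 * p` are admissible, the
greatest common divisor is `p`. -/

theorem tendsto_average_of_tendsto_squares {D : ℕ → ℝ} {C : ℝ} (hb : ∀ i, |D i| ≤ C)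
    (h : Tendsto (fun k : ℕ => (∑ i ∈ Finset.range ((k + 1) ^ 2), D i) / ((k : ℝ) + 1) ^ 2)
      atTop (𝓝 0)) :
    Tendsto (fun n : ℕ => (∑ i ∈ Finset.range n, D i) / (n : ℝ)) atTop (𝓝 0) := by
  have hC : 0 ≤ C := (abs_nonneg _).trans (hb 0)
  have hsqrt : Tendsto (fun n : ℕ => Nat.sqrt n - 1) atTop atTop := by
    refine tendsto_atTop.2 fun b => ?_
    filter_upwards [eventually_ge_atTop ((b + 1) ^ 2)] with n hn
    have : b + 1 ≤ Nat.sqrt n := Nat.le_sqrt'.2 hn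
    omega
  have h1 := h.abs.comp hsqrt
  have h2 : Tendsto (fun k : ℕ => 2 * C * (1 / ((k : ℝ) + 1))) atTop (𝓝 0) := by
    simpa using tendsto_one_div_add_atTop_nhds_zero_nat.const_mul (2 * C)
  have h3 := h1.add (h2.comp hsqrt)
  rw [abs_zero, add_zero] at h3
  refine squeeze_zero_norm' ?_ h3
  filter_upwards [eventually_ge_atTop 1] with n hn
  obtain ⟨k, hk⟩ : ∃ k, Nat.sqrt n = k + 1 :=
    ⟨Nat.sqrt n - 1, by have : 1 ≤ Nat.sqrt n := Nat.le_sqrt'.2 (by simpa using hn); omega⟩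
  have hle : (k + 1) ^ 2 ≤ n := by rw [← hk]; exact Nat.sqrt_le' n
  -- Consecutive squares are so close that at most `2 * (k + 1)` terms lie beyond the last square;
  -- after division by `(k + 1) ^ 2` they contribute only `O(1 / k)`.
  have hlt : n ≤ (k + 1) ^ 2 + 2 * (k + 1) := by
    have := Nat.sqrt_le_add n
    rw [hk] at this
    nlinarith
  simp only [Function.comp_apply, hk, Nat.add_sub_cancel, Real.norm_eq_abs]
  have hsplit : |∑ i ∈ Finset.range n, D i| ≤
      |∑ i ∈ Finset.range ((k + 1) ^ 2), D i| + 2 * C * ((k : ℝ) + 1) := by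
    rw [← Finset.sum_range_add_sum_Ico _ hle]
    refine (abs_add_le _ _).trans (add_le_add le_rfl ?_)
    refine (Finset.abs_sum_le_sum_abs _ _).trans ((Finset.sum_le_card_nsmul _ _ C
      fun i _ => hb i).trans ?_)
    rw [Nat.card_Ico, nsmul_eq_mul]
    have : ((n - (k + 1) ^ 2 : ℕ) : ℝ) ≤ 2 * ((k : ℝ) + 1) := by
      have : n - (k + 1) ^ 2 ≤ 2 * (k + 1) := by omega
      exact_mod_cast this
    nlinarith
  have hk0 : (0 : ℝ) < (k : ℝ) + 1 := by positivity
  have hnR : ((k : ℝ) + 1) ^ 2 ≤ n := by exact_mod_cast hle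
  rw [abs_div, abs_div, abs_of_pos (by positivity : (0 : ℝ) < ((k : ℝ) + 1) ^ 2),
    abs_of_nonneg (by positivity : (0 : ℝ) ≤ (n : ℝ))]
  calc |∑ i ∈ Finset.range n, D i| / n
      ≤ (|∑ i ∈ Finset.range ((k + 1) ^ 2), D i| + 2 * C * ((k : ℝ) + 1)) / ((k : ℝ) + 1) ^ 2 := by
        gcongr
    _ = _ := by field_simp

/-- Orthogonality bounds the second moment of the sum of `n` terms by `n * C ^ 2`. Along squares the
averages thus have summable second moments and vanish almost surely in the limit; boundedness fills
the gaps between squares. -/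
theorem ae_tendsto_average_of_orthogonal {Ω : Type*} [MeasurableSpace Ω] (μ : Measure Ω)
    [IsProbabilityMeasure μ] (D : ℕ → Ω → ℝ) (C : ℝ) (hm : ∀ i, Measurable (D i))
    (hb : ∀ i ω, |D i ω| ≤ C) (ho : ∀ i j, i < j → ∫ ω, D i ω * D j ω ∂μ = 0) :
    ∀ᵐ ω ∂μ, Tendsto (fun n : ℕ => (∑ i ∈ Finset.range n, D i ω) / (n : ℝ)) atTop (𝓝 0) := by
  have hint : ∀ i j, Integrable (fun ω => D i ω * D j ω) μ := fun i j =>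
    Integrable.of_bound ((hm i).mul (hm j)).aestronglyMeasurable (C * C)
      (ae_of_all _ fun ω => by
        rw [norm_mul]
        exact mul_le_mul (hb i ω) (hb j ω) (norm_nonneg _) ((abs_nonneg _).trans (hb i ω)))
  have hMm : ∀ n, Measurable fun ω => ∑ i ∈ Finset.range n, D i ω := fun n =>
    Finset.measurable_sum _ fun i _ => hm i
  have hsq : ∀ n : ℕ, Integrable (fun ω => (∑ i ∈ Finset.range n, D i ω) ^ 2) μ ∧
      ∫ ω, (∑ i ∈ Finset.range n, D i ω) ^ 2 ∂μ ≤ n * C ^ 2 := by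
    intro n
    induction n with
    | zero => simp
    | succ n ih =>
      have hexp : ∀ ω, (∑ i ∈ Finset.range (n + 1), D i ω) ^ 2 =
          (∑ i ∈ Finset.range n, D i ω) ^ 2 + (2 * ∑ i ∈ Finset.range n, D i ω * D n ω) +
            D n ω * D n ω := fun ω => by
        rw [Finset.sum_range_succ, ← Finset.sum_mul]; ring
      have hi2 : Integrable (fun ω => 2 * ∑ i ∈ Finset.range n, D i ω * D n ω) μ :=
        (integrable_finsetSum _ fun i _ => hint i n).const_mul 2
      simp only [hexp]
      refine ⟨(ih.1.add hi2).add (hint n n), ?_⟩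
      rw [integral_add (f := fun ω => _ + _) (ih.1.add hi2) (hint n n), integral_add ih.1 hi2, integral_const_mul,
        integral_finsetSum _ fun i _ => hint i n,
        Finset.sum_eq_zero fun i hi => ho i n (Finset.mem_range.1 hi)]
      have : ∫ ω, D n ω * D n ω ∂μ ≤ ∫ _, C ^ 2 ∂μ :=
        integral_mono (hint n n) (integrable_const _) fun ω => by
          have := sq_le_sq.2 ((hb n ω).trans (le_abs_self C))
          simpa [sq] using this
      simp only [integral_const, probReal_univ, one_smul] at this
      push_cast
      linarith [ih.2]
  set Y : ℕ → Ω → ℝ := fun k ω =>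
    (∑ i ∈ Finset.range ((k + 1) ^ 2), D i ω) / ((k : ℝ) + 1) ^ 2 with hY
  have hYm : ∀ k, Measurable (Y k) := fun k => (hMm _).div_const _
  have hYi : ∀ k, ∫⁻ ω, ENNReal.ofReal (Y k ω ^ 2) ∂μ ≤
      ENNReal.ofReal (C ^ 2 * (1 / ((k : ℝ) + 1) ^ 2)) := by
    intro k
    have he : ∀ ω, Y k ω ^ 2 =
        (∑ i ∈ Finset.range ((k + 1) ^ 2), D i ω) ^ 2 * (1 / ((k : ℝ) + 1) ^ 4) := fun ω => by
      simp only [hY]; field_simp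
    simp only [he]
    rw [← ofReal_integral_eq_lintegral_ofReal ((hsq _).1.mul_const _)
      (ae_of_all _ fun ω => by positivity), integral_mul_const]
    refine ENNReal.ofReal_le_ofReal ?_
    calc _ ≤ (((k + 1) ^ 2 : ℕ) * C ^ 2) * (1 / ((k : ℝ) + 1) ^ 4) := by
          gcongr; exact (hsq _).2
      _ = _ := by push_cast; field_simp
  have hsum : ∫⁻ ω, ∑' k, ENNReal.ofReal (Y k ω ^ 2) ∂μ ≠ ⊤ := by
    rw [lintegral_tsum fun k => ((hYm k).pow_const 2).ennreal_ofReal.aemeasurable]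
    have hs : Summable fun k : ℕ => C ^ 2 * (1 / ((k : ℝ) + 1) ^ 2) := by
      refine Summable.mul_left _ ?_
      have := (summable_nat_add_iff 1).2 (Real.summable_one_div_nat_pow.2 one_lt_two)
      simpa using this
    refine ne_top_of_le_ne_top hs.tsum_ofReal_ne_top (ENNReal.tsum_le_tsum hYi)
  have hfin := ae_lt_top (Measurable.tsum fun k => ((hYm k).pow_const 2).ennreal_ofReal) hsum
  filter_upwards [hfin] with ω hω
  refine tendsto_average_of_tendsto_squares (fun i => hb i ω) ?_
  have h0 := ENNReal.tendsto_atTop_zero_of_tsum_ne_top hω.ne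
  have h1 := (ENNReal.tendsto_toReal ENNReal.zero_ne_top).comp h0
  have h2 : Tendsto (fun k => Y k ω ^ 2) atTop (𝓝 0) := by
    refine h1.congr fun k => ?_
    simp [sq_nonneg]
  have h3 := h2.sqrt
  simp only [Real.sqrt_sq_eq_abs, Real.sqrt_zero] at h3
  exact (tendsto_zero_iff_abs_tendsto_zero _).2 h3

/-! ### Walks driven by state-dependent independent steps -/

/-- The walk on `ℤ` started at `0` whose `n`-th step is `u n c`, where `c` is the residue class of
the current position, shifted by `s`. -/
def drivenWalk {N : ℕ} (s : ZMod N) (u : ℕ → ZMod N → ℤ) : ℕ → ℤ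
  | 0 => 0
  | n + 1 => drivenWalk s u n + u n (s + (drivenWalk s u n : ℤ))

theorem drivenWalk_congr {N : ℕ} (s : ZMod N) {u v : ℕ → ZMod N → ℤ} {n : ℕ}
    (h : ∀ i < n, u i = v i) : drivenWalk s u n = drivenWalk s v n := by
  induction n with
  | zero => rfl
  | succ n ih => rw [drivenWalk, drivenWalk, ih fun i hi => h i (by omega), h n (by omega)]

theorem measurable_drivenWalk {N : ℕ} [NeZero N] {Ω : Type*} [MeasurableSpace Ω] (s : ZMod N)
    {ξ : ℕ → Ω → ZMod N → ℤ} (hξ : ∀ n, Measurable (ξ n)) (n : ℕ) :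
    Measurable fun ω => drivenWalk s (fun i => ξ i ω) n := by
  induction n with
  | zero => exact measurable_const
  | succ n ih =>
    have : Measurable fun y : (ZMod N → ℤ) × ℤ => y.2 + y.1 (s + (y.2 : ℤ)) :=
      Measurable.of_discrete
    exact this.comp ((hξ n).prodMk ih)

theorem indepFun_of_depends_on_prefix {N : ℕ} [NeZero N] {Ω : Type*} [MeasurableSpace Ω]
    {μ : Measure Ω} {ξ : ℕ → Ω → ZMod N → ℤ} (hξ : ∀ n, Measurable (ξ n)) (hi : iIndepFun ξ μ)
    {j : ℕ} {F : (ℕ → ZMod N → ℤ) → ℝ} (hF : ∀ u v, (∀ i < j, u i = v i) → F u = F v) :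
    IndepFun (fun ω => F fun i => ξ i ω) (ξ j) μ := by
  have h := hi.indepFun_finset (Finset.range j) {j} (by simp) hξ
  have h2 := h.comp
    (φ := fun t : Finset.range j → ZMod N → ℤ =>
      -- Values beyond the prefix are irrelevant to `F`. Padding with `0` makes it a function on a
      -- countable discrete space, where measurability is automatic.
      F fun i => if hi : i ∈ Finset.range j then t ⟨i, hi⟩ else 0)
    (ψ := fun t : ({j} : Finset ℕ) → ZMod N → ℤ => t ⟨j, Finset.mem_singleton_self j⟩)
    Measurable.of_discrete Measurable.of_discrete
  convert h2 using 1
  · funext ω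
    exact hF _ _ fun i hi => by simp [hi]
  · rfl

/-! ### Ergodic theorem for the chain on residue classes -/

/-- The averaging operator of the chain on residue classes with step laws `κ`. -/
def avgOp {N : ℕ} (κ : ZMod N → Measure ℤ) (g : ZMod N → ℝ) (c : ZMod N) : ℝ :=
  ∫ z : ℤ, g (c + (z : ZMod N)) ∂κ c

theorem abs_avgOp_le {N : ℕ} (κ : ZMod N → Measure ℤ) [∀ c, IsProbabilityMeasure (κ c)]
    {g : ZMod N → ℝ} {C : ℝ} (hC : ∀ a, |g a| ≤ C) (c : ZMod N) : |avgOp κ g c| ≤ C := by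
  have := norm_integral_le_of_norm_le_const (μ := κ c) (f := fun z : ℤ => g (c + (z : ZMod N)))
    (ae_of_all _ fun z => hC _)
  simpa [avgOp] using this

variable {N : ℕ} [NeZero N]

theorem integrable_shift (κ : ZMod N → Measure ℤ) [∀ c, IsProbabilityMeasure (κ c)]
    (g : ZMod N → ℝ) (c b : ZMod N) : Integrable (fun z : ℤ => g (c + (z : ZMod N))) (κ b) := by
  refine Integrable.of_bound Measurable.of_discrete.aestronglyMeasurable (∑ a, |g a|)
    (ae_of_all _ fun z => ?_)
  exact Finset.single_le_sum (f := fun a => |g a|) (fun a _ => abs_nonneg _) (Finset.mem_univ _)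

/-- A harmonic function of an irreducible finite chain is constant. -/
theorem eq_of_avgOp_eq (κ : ZMod N → Measure ℤ) [∀ c, IsProbabilityMeasure (κ c)]
    (hpos : ∀ c z, κ c {z} ≠ 0) {g : ZMod N → ℝ} (hg : ∀ c, avgOp κ g c = g c) (a b : ZMod N) :
    g a = g b := by
  -- Maximum principle: at a maximiser `c` the nonnegative defect `g c - g (c + z)` has mean zero,
  -- and every `z` has positive mass, so the defect vanishes at every class.
  obtain ⟨c, hc⟩ := Finite.exists_max g
  suffices h : ∀ b, g b = g c by rw [h a, h b]
  intro b
  have h0 : ∫ z : ℤ, (g c - g (c + (z : ZMod N))) ∂κ c = 0 := by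
    rw [integral_sub (integrable_const _) (integrable_shift κ g c c)]
    have := hg c
    simp only [avgOp] at this
    simp [this]
  rw [integral_eq_zero_iff_of_nonneg (fun z => sub_nonneg.2 (hc _))
    ((integrable_const _).sub (integrable_shift κ g c c))] at h0
  obtain ⟨z, hz⟩ := ZMod.intCast_surjective (b - c)
  have h1 : g c - g (c + (z : ZMod N)) = 0 := by
    by_contra hne
    refine hpos c z (measure_mono_null ?_ (ae_iff.1 h0))
    rintro _ rfl
    exact hne
  rw [hz] at h1
  simp only [add_sub_cancel] at h1
  linarith

/-- Adding the `α`-mean to `g - avgOp κ g` removes the constants from the kernel: if the result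
vanishes, pairing with `α` gives mean zero, so `g` is harmonic, hence constant, hence zero. In
finite dimension injectivity gives surjectivity, and for centred `f` the added mean of the solution
is zero. -/
theorem exists_poisson_solution (κ : ZMod N → Measure ℤ) [∀ c, IsProbabilityMeasure (κ c)]
    (hpos : ∀ c z, κ c {z} ≠ 0) {α : ZMod N → ℝ} (hα : ∑ a, α a = 1)
    (hst : ∀ g : ZMod N → ℝ, ∑ a, α a * avgOp κ g a = ∑ a, α a * g a)
    {f : ZMod N → ℝ} (hf : ∑ a, α a * f a = 0) :
    ∃ g : ZMod N → ℝ, ∀ c, g c - avgOp κ g c = f c := by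
  have hadd : ∀ g h : ZMod N → ℝ, ∀ c, avgOp κ (g + h) c = avgOp κ g c + avgOp κ h c :=
    fun g h c => integral_add (integrable_shift κ g c c) (integrable_shift κ h c c)
  have hsmul : ∀ (r : ℝ) (g : ZMod N → ℝ), ∀ c, avgOp κ (r • g) c = r * avgOp κ g c :=
    fun r g c => integral_const_mul r _
  let T : (ZMod N → ℝ) →ₗ[ℝ] (ZMod N → ℝ) :=
    { toFun := fun g c => g c - avgOp κ g c + ∑ a, α a * g a
      map_add' := fun g h => by
        funext c
        simp only [hadd, Pi.add_apply, mul_add, Finset.sum_add_distrib]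
        ring
      map_smul' := fun r g => by
        funext c
        simp only [hsmul, Pi.smul_apply, smul_eq_mul, RingHom.id_apply, mul_add, Finset.mul_sum,
          mul_sub]
        congr 1
        exact Finset.sum_congr rfl fun a _ => by ring }
  have hT : ∀ g c, T g c = g c - avgOp κ g c + ∑ a, α a * g a := fun _ _ => rfl
  have hαT : ∀ g, ∑ a, α a * T g a = ∑ a, α a * g a := fun g => by
    simp only [hT, mul_add, mul_sub, Finset.sum_add_distrib, Finset.sum_sub_distrib, hst,
      ← Finset.sum_mul, hα]
    ring
  have hinj : Function.Injective T := by
    rw [← LinearMap.ker_eq_bot, LinearMap.ker_eq_bot']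
    intro g hg
    have h0 : ∑ a, α a * g a = 0 := by rw [← hαT, hg]; simp
    have h1 : ∀ c, avgOp κ g c = g c := fun c => by
      have := hT g c
      rw [hg, h0] at this
      simp only [Pi.zero_apply] at this
      linarith
    funext c
    have h2 : ∑ a, α a * g a = g c := by
      rw [Finset.sum_congr rfl fun a _ => by rw [eq_of_avgOp_eq κ hpos h1 a c], ← Finset.sum_mul,
        hα, one_mul]
    rw [← h2, h0]; rfl
  obtain ⟨g, hg⟩ := LinearMap.injective_iff_surjective.1 hinj f
  refine ⟨g, fun c => ?_⟩
  have h0 : ∑ a, α a * g a = 0 := by rw [← hαT, hg, hf]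
  have := hT g c
  rw [hg, h0] at this
  linarith

/-- The Poisson solution `g` turns the sum of `f` along the walk into a sum of martingale
differences plus a bounded telescoping remainder. -/
theorem ae_tendsto_average_drivenWalk (κ : ZMod N → Measure ℤ)
    [∀ c, IsProbabilityMeasure (κ c)] (hpos : ∀ c z, κ c {z} ≠ 0) {α : ZMod N → ℝ}
    (hα : ∑ a, α a = 1) (hst : ∀ g : ZMod N → ℝ, ∑ a, α a * avgOp κ g a = ∑ a, α a * g a)
    {Ω : Type*} [MeasurableSpace Ω] {μ : Measure Ω} [IsProbabilityMeasure μ]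
    {ξ : ℕ → Ω → ZMod N → ℤ} (hξ : ∀ n, Measurable (ξ n)) (hi : iIndepFun ξ μ)
    (hlaw : ∀ n c, μ.map (fun ω => ξ n ω c) = κ c) (s : ZMod N)
    {f : ZMod N → ℝ} (hf : ∑ a, α a * f a = 0) :
    ∀ᵐ ω ∂μ, Tendsto (fun n : ℕ => (∑ i ∈ Finset.range n,
      f (s + (drivenWalk s (fun k => ξ k ω) i : ℤ))) / (n : ℝ)) atTop (𝓝 0) := by
  obtain ⟨g, hg⟩ := exists_poisson_solution κ hpos hα hst hf
  set C := ∑ a, |g a|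
  have hgC : ∀ a, |g a| ≤ C := fun a =>
    Finset.single_le_sum (f := fun a => |g a|) (fun a _ => abs_nonneg _) (Finset.mem_univ _)
  have hpC : ∀ a, |avgOp κ g a| ≤ C := abs_avgOp_le κ hgC
  let st : (ℕ → ZMod N → ℤ) → ℕ → ZMod N := fun u j => s + (drivenWalk s u j : ℤ)
  let D : (ℕ → ZMod N → ℤ) → ℕ → ℝ := fun u j => g (st u (j + 1)) - avgOp κ g (st u j)
  have hst_succ : ∀ u j, st u (j + 1) = st u j + (u j (st u j) : ℤ) := fun u j => by
    simp only [st, drivenWalk, Int.cast_add, add_assoc]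
  have hst_congr : ∀ {u v : ℕ → ZMod N → ℤ} {j}, (∀ i < j, u i = v i) → st u j = st v j :=
    fun h => by simp only [st, drivenWalk_congr s h]
  have hcompm : ∀ (φ : ZMod N → ℝ) j, Measurable fun ω => φ (st (fun k => ξ k ω) j) :=
    fun φ j => (Measurable.of_discrete (f := fun z : ℤ => φ (s + (z : ZMod N)))).comp
      (measurable_drivenWalk s hξ j)
  have hDm : ∀ j, Measurable fun ω => D (fun k => ξ k ω) j := fun j =>
    (hcompm g (j + 1)).sub (hcompm (avgOp κ g) j)
  have hDb : ∀ u j, |D u j| ≤ 2 * C := fun u j => by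
    have h1 := abs_le.1 (hgC (st u (j + 1)))
    have h2 := abs_le.1 (hpC (st u j))
    exact abs_le.2 ⟨by simp only [D]; linarith, by simp only [D]; linarith⟩
  have horth : ∀ i j, i < j → ∫ ω, D (fun k => ξ k ω) i * D (fun k => ξ k ω) j ∂μ = 0 := by
    intro i j hij
    -- Splitting by the class `c` occupied at time `j` factors the product into `F c`, which depends
    -- on the past only, and `W c`, a centred function of the independent innovation `j`.
    let F : ZMod N → (ℕ → ZMod N → ℤ) → ℝ := fun c u => (if st u j = c then 1 else 0) * D u i
    let W : ZMod N → (ZMod N → ℤ) → ℝ := fun c t => g (c + (t c : ℤ)) - avgOp κ g c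
    have hdec : ∀ u, D u i * D u j = ∑ c, F c u * W c (u j) := fun u => by
      simp only [F, ite_mul, one_mul, zero_mul, Finset.sum_ite_eq, Finset.mem_univ, if_true]
      simp only [W, D, hst_succ u j]
    have hFm : ∀ c, Measurable fun ω => F c fun k => ξ k ω := fun c =>
      (hcompm (fun a => if a = c then 1 else 0) j).mul (hDm i)
    have hWm : ∀ c, Measurable fun ω => W c (ξ j ω) := fun c =>
      (Measurable.of_discrete (f := W c)).comp (hξ j)
    have hFb : ∀ c u, |F c u| ≤ 2 * C := fun c u => by
      simp only [F]
      split_ifs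
      · simpa using hDb u i
      · simpa using (abs_nonneg _).trans (hDb u i)
    have hWb : ∀ c t, |W c t| ≤ 2 * C := fun c t => by
      have h1 := abs_le.1 (hgC (c + (t c : ℤ)))
      have h2 := abs_le.1 (hpC c)
      exact abs_le.2 ⟨by simp only [W]; linarith, by simp only [W]; linarith⟩
    have hC0 : 0 ≤ 2 * C := (abs_nonneg _).trans (hWb 0 0)
    simp only [hdec]
    rw [integral_finsetSum]
    · refine Finset.sum_eq_zero fun c _ => ?_
      have hFpre : ∀ u v : ℕ → ZMod N → ℤ, (∀ i < j, u i = v i) → F c u = F c v := by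
        intro u v h
        simp only [F, D, hst_congr h, hst_congr (j := i) fun k hk => h k (by omega),
          hst_congr (j := i + 1) fun k hk => h k (by omega)]
      have hind := (indepFun_of_depends_on_prefix hξ hi hFpre).comp
        (φ := id) (ψ := W c) measurable_id Measurable.of_discrete
      have hmul := hind.integral_fun_mul_eq_mul_integral (hFm c).aestronglyMeasurable
        (hWm c).aestronglyMeasurable
      have hzero : ∫ ω, W c (ξ j ω) ∂μ = 0 := by
        have hm : Measurable fun ω => ξ j ω c := (measurable_pi_apply c).comp (hξ j)
        have := integral_map (μ := μ) hm.aemeasurable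
          (f := fun z : ℤ => g (c + (z : ZMod N)) - avgOp κ g c)
          Measurable.of_discrete.aestronglyMeasurable
        rw [hlaw, integral_sub (integrable_shift κ g c c) (integrable_const _)] at this
        simp only [W]
        rw [← this]
        simp [avgOp]
      simp only [Function.comp_apply, id_eq] at hmul
      rw [hmul, hzero, mul_zero]
    · intro c _
      refine Integrable.of_bound ((hFm c).mul (hWm c)).aestronglyMeasurable (2 * C * (2 * C))
        (ae_of_all _ fun ω => ?_)
      rw [norm_mul]
      exact mul_le_mul (hFb _ _) (hWb _ _) (norm_nonneg _) hC0
  filter_upwards [ae_tendsto_average_of_orthogonal μ (fun j ω => D (fun k => ξ k ω) j) (2 * C)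
    hDm (fun j ω => hDb _ j) horth] with ω hω
  set u : ℕ → ZMod N → ℤ := fun k => ξ k ω
  have htel : ∀ n, ∑ i ∈ Finset.range n, f (st u i) =
      ∑ i ∈ Finset.range n, D u i + (g (st u 0) - g (st u n)) := by
    intro n
    induction n with
    | zero => simp
    | succ n ih =>
      rw [Finset.sum_range_succ, Finset.sum_range_succ, ih, ← hg]
      simp only [D]
      ring
  have hbd : Tendsto (fun n : ℕ => (g (st u 0) - g (st u n)) / (n : ℝ)) atTop (𝓝 0) := by
    refine squeeze_zero_norm (a := fun n : ℕ => (2 * C) / (n : ℝ)) (fun n => ?_)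
      (tendsto_const_div_atTop_nhds_zero_nat _)
    rw [norm_div, Real.norm_eq_abs, Real.norm_natCast]
    gcongr
    have h1 := abs_le.1 (hgC (st u 0))
    have h2 := abs_le.1 (hgC (st u n))
    exact abs_le.2 ⟨by linarith, by linarith⟩
  have := hω.add hbd
  rw [add_zero] at this
  refine this.congr fun n => ?_
  rw [← add_div, ← htel]

end MarkovChain

/-! ### One-step transition weights of a periodic boundary law -/

/-- The normalisation `∑ z, Q z * lam (i + z)` of the jump distribution from the class `i`. -/
def stepNorm (Q : ℤ → ℝ) {q : ℕ} (lam : ZMod q → ℝ) (i : ZMod q) : ℝ :=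
  ∑' z : ℤ, Q z * lam (i + (z : ZMod q))

/-- The probability of the integer increment `z` from the class `i`. -/
def stepWeight (Q : ℤ → ℝ) {q : ℕ} (lam : ZMod q → ℝ) (i : ZMod q) (z : ℤ) : ℝ :=
  Q z * lam (i + (z : ZMod q)) / stepNorm Q lam i

section Step

variable {d q : ℕ} [NeZero q] {Q : ℤ → ℝ} {lam : ZMod q → ℝ}

theorem IsPeriodicBoundaryLaw.pos (h : IsPeriodicBoundaryLaw d Q q lam) (i : ZMod q) :
    0 < lam i := by
  obtain ⟨z, rfl⟩ := ZMod.intCast_surjective i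
  exact h.1 z

theorem summable_mul_periodic (hQ : IsTransferOperator Q) (f : ℤ → ZMod q) (g : ZMod q → ℝ) :
    Summable fun z : ℤ => Q z * g (f z) := by
  refine Summable.of_norm_bounded (hQ.summable.mul_right (∑ a, |g a|)) fun z => ?_
  rw [norm_mul, Real.norm_of_nonneg (hQ.pos z).le]
  exact mul_le_mul_of_nonneg_left
    (Finset.single_le_sum (f := fun a => |g a|) (fun a _ => abs_nonneg _) (Finset.mem_univ _))
    (hQ.pos z).le

theorem stepNorm_pos (hQ : IsTransferOperator Q) (hlam : ∀ i, 0 < lam i) (i : ZMod q) :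
    0 < stepNorm Q lam i :=
  (summable_mul_periodic hQ _ lam).tsum_pos (fun z => (mul_pos (hQ.pos z) (hlam _)).le) 0
    (mul_pos (hQ.pos 0) (hlam _))

theorem stepWeight_pos (hQ : IsTransferOperator Q) (hlam : ∀ i, 0 < lam i) (i : ZMod q) (z : ℤ) :
    0 < stepWeight Q lam i z :=
  div_pos (mul_pos (hQ.pos z) (hlam _)) (stepNorm_pos hQ hlam i)

theorem hasSum_stepWeight (hQ : IsTransferOperator Q) (hlam : ∀ i, 0 < lam i) (i : ZMod q) :
    HasSum (stepWeight Q lam i) 1 := by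
  have := (summable_mul_periodic hQ (fun z : ℤ => i + (z : ZMod q)) lam).hasSum.div_const
    (stepNorm Q lam i)
  rwa [← stepNorm, div_self (stepNorm_pos hQ hlam i).ne'] at this

theorem fuzzyQ_neg (hQ : IsTransferOperator Q) (s : ZMod q) : fuzzyQ Q q (-s) = fuzzyQ Q q s := by
  unfold fuzzyQ
  rw [← (Equiv.neg ℤ).tsum_eq]
  refine tsum_congr fun l => ?_
  simp only [Equiv.neg_apply, Int.cast_neg, neg_inj, hQ.symm]

theorem summable_fuzzyQ (hQ : IsTransferOperator Q) (s : ZMod q) :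
    Summable fun l : ℤ => if (l : ZMod q) = s then Q l else 0 := by
  simpa using summable_mul_periodic hQ (fun l : ℤ => (l : ZMod q)) fun a => if a = s then 1 else 0

theorem fuzzyQ_pos (hQ : IsTransferOperator Q) (s : ZMod q) : 0 < fuzzyQ Q q s := by
  obtain ⟨z, rfl⟩ := ZMod.intCast_surjective s
  refine (summable_fuzzyQ hQ _).tsum_pos (fun l => ?_) z (by simp [hQ.pos])
  split_ifs
  exacts [(hQ.pos l).le, le_rfl]

theorem sum_fuzzyQ_mul (hQ : IsTransferOperator Q) (lam : ZMod q → ℝ) (i : ZMod q) :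
    ∑ s, fuzzyQ Q q (i - s) * lam s = stepNorm Q lam i := by
  have h1 : ∀ s, fuzzyQ Q q (i - s) = fuzzyQ Q q (s - i) := fun s => by
    rw [← fuzzyQ_neg hQ, neg_sub]
  simp only [h1]
  unfold fuzzyQ stepNorm
  simp only [← tsum_mul_right]
  rw [← Summable.tsum_finsetSum fun s _ => (summable_fuzzyQ hQ (s - i)).mul_right (lam s)]
  refine tsum_congr fun z => ?_
  rw [Finset.sum_eq_single (i + (z : ZMod q))]
  · simp
  · intro b _ hb
    rw [if_neg, zero_mul]
    rintro h
    exact hb (by rw [h]; ring)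
  · simp

/-- The product of the fuzzy transition probability and the conditional increment law is the
weight of the integer increment, if the latter is compatible with the fuzzy increment. -/
theorem fuzzyP_mul_rho (hQ : IsTransferOperator Q) (lam : ZMod q → ℝ) (i j : ZMod q) (z : ℤ) :
    fuzzyP Q q lam i j * rho Q q z (j - i) =
      if (z : ZMod q) = j - i then stepWeight Q lam i z else 0 := by
  unfold fuzzyP rho stepWeight
  split_ifs with h
  · have hj : i + (z : ZMod q) = j := by rw [h]; ring
    rw [sum_fuzzyQ_mul hQ, hj, ← fuzzyQ_neg hQ (i - j), neg_sub]
    have := (fuzzyQ_pos hQ (j - i)).ne'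
    field_simp
  · rw [mul_zero]

theorem tsum_transfer_eq_stepNorm (hQ : IsTransferOperator Q) (lam : ZMod q → ℝ) (i : ℤ) :
    ∑' j : ℤ, Q (i - j) * lam (j : ZMod q) = stepNorm Q lam (i : ZMod q) := by
  unfold stepNorm
  rw [← (Equiv.addLeft i).tsum_eq]
  refine tsum_congr fun z => ?_
  rw [Equiv.coe_addLeft, sub_add_cancel_left, hQ.symm, Int.cast_add]

theorem IsPeriodicBoundaryLaw.exists_eq (hQ : IsTransferOperator Q)
    (h : IsPeriodicBoundaryLaw d Q q lam) :
    ∃ c : ℝ, 0 < c ∧ ∀ i, lam i = c * stepNorm Q lam i ^ d := by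
  obtain ⟨c, hc, h⟩ := h.2.2
  refine ⟨c, hc, fun i => ?_⟩
  obtain ⟨z, rfl⟩ := ZMod.intCast_surjective i
  rw [← tsum_transfer_eq_stepNorm hQ]
  exact h z

theorem sum_rpow_pos (hlam : ∀ i, 0 < lam i) (β : ℝ) : 0 < ∑ s, lam s ^ β :=
  Finset.sum_pos (fun i _ => Real.rpow_pos_of_pos (hlam i) _) Finset.univ_nonempty

theorem fuzzyAlpha_pos (d : ℕ) (hlam : ∀ i, 0 < lam i) (i : ZMod q) : 0 < fuzzyAlpha d q lam i :=
  div_pos (Real.rpow_pos_of_pos (hlam i) _) (sum_rpow_pos hlam _)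

theorem sum_fuzzyAlpha (d : ℕ) (hlam : ∀ i, 0 < lam i) : ∑ i, fuzzyAlpha d q lam i = 1 := by
  unfold fuzzyAlpha
  rw [← Finset.sum_div, div_self (sum_rpow_pos hlam _).ne']

theorem fuzzyAlpha_mem_stdSimplex (d : ℕ) (hlam : ∀ i, 0 < lam i) :
    fuzzyAlpha d q lam ∈ stdSimplex ℝ (ZMod q) :=
  ⟨fun i => (fuzzyAlpha_pos d hlam i).le, sum_fuzzyAlpha d hlam⟩

/-- The `d`-th root of the boundary law equation identifies `lam ^ (1 / d)` with a multiple of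
`stepNorm`; this is what makes the chain reversible. -/
theorem exists_fuzzyAlpha_eq (hd : d ≠ 0) (hQ : IsTransferOperator Q)
    (h : IsPeriodicBoundaryLaw d Q q lam) :
    ∃ K : ℝ, ∀ i, fuzzyAlpha d q lam i = K * lam i * stepNorm Q lam i := by
  obtain ⟨c, hc, hlam⟩ := h.exists_eq hQ
  have hd' : (d : ℝ) ≠ 0 := by exact_mod_cast hd
  refine ⟨c ^ (1 / (d : ℝ)) / ∑ s, lam s ^ (((d : ℝ) + 1) / d), fun i => ?_⟩
  have hT := stepNorm_pos hQ h.pos i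
  have hroot : lam i ^ (1 / (d : ℝ)) = c ^ (1 / (d : ℝ)) * stepNorm Q lam i := by
    rw [hlam i, Real.mul_rpow hc.le (by positivity), one_div, Real.pow_rpow_inv_natCast hT.le hd]
  unfold fuzzyAlpha
  rw [add_div, div_self hd', Real.rpow_add (h.pos i), Real.rpow_one, hroot]
  ring

/-- Detailed balance. -/
theorem fuzzyAlpha_mul_stepWeight (hd : d ≠ 0) (hQ : IsTransferOperator Q)
    (h : IsPeriodicBoundaryLaw d Q q lam) :
    ∃ K : ℝ, ∀ i (z : ℤ), fuzzyAlpha d q lam i * stepWeight Q lam i z =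
      K * Q z * lam i * lam (i + (z : ZMod q)) := by
  obtain ⟨K, hK⟩ := exists_fuzzyAlpha_eq hd hQ h
  refine ⟨K, fun i z => ?_⟩
  have := (stepNorm_pos hQ h.pos i).ne'
  rw [hK, stepWeight]
  field_simp

theorem fuzzyAlpha_mul_stepWeight_symm (hd : d ≠ 0) (hQ : IsTransferOperator Q)
    (h : IsPeriodicBoundaryLaw d Q q lam) (i : ZMod q) (z : ℤ) :
    fuzzyAlpha d q lam i * stepWeight Q lam i z = fuzzyAlpha d q lam (i + (z : ZMod q)) *
      stepWeight Q lam (i + (z : ZMod q)) (-z) := by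
  obtain ⟨K, hK⟩ := fuzzyAlpha_mul_stepWeight hd hQ h
  rw [hK, hK, hQ.symm]
  simp only [Int.cast_neg, add_neg_cancel_right]
  ring

/-! ### The step laws as measures -/

/-- The law of the integer increment from the class `i`. -/
def stepLaw (Q : ℤ → ℝ) {q : ℕ} (lam : ZMod q → ℝ) (i : ZMod q) : Measure ℤ :=
  Measure.sum fun z => ENNReal.ofReal (stepWeight Q lam i z) • Measure.dirac z

theorem stepLaw_singleton (i : ZMod q) (z : ℤ) :
    stepLaw Q lam i {z} = ENNReal.ofReal (stepWeight Q lam i z) := by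
  rw [stepLaw, Measure.sum_apply _ (measurableSet_singleton z), tsum_eq_single z]
  · simp
  · intro b hb
    simp [hb]

theorem isProbabilityMeasure_stepLaw (hQ : IsTransferOperator Q) (hlam : ∀ i, 0 < lam i)
    (i : ZMod q) : IsProbabilityMeasure (stepLaw Q lam i) := by
  refine ⟨?_⟩
  have h := hasSum_stepWeight hQ hlam i
  rw [stepLaw, Measure.sum_apply _ MeasurableSet.univ]
  simp only [Measure.smul_apply, measure_univ, smul_eq_mul, mul_one]
  rw [← ENNReal.ofReal_tsum_of_nonneg (fun z => (stepWeight_pos hQ hlam i z).le) h.summable,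
    h.tsum_eq, ENNReal.ofReal_one]

theorem avgOp_stepLaw (hQ : IsTransferOperator Q) (hlam : ∀ i, 0 < lam i) (g : ZMod q → ℝ)
    (c : ZMod q) :
    avgOp (stepLaw Q lam) g c = ∑' z : ℤ, stepWeight Q lam c z * g (c + (z : ZMod q)) := by
  have := isProbabilityMeasure_stepLaw hQ hlam
  rw [avgOp, integral_countable (integrable_shift _ g c c)]
  refine tsum_congr fun z => ?_
  rw [measureReal_def, stepLaw_singleton, ENNReal.toReal_ofReal (stepWeight_pos hQ hlam c z).le,
    smul_eq_mul]

/-- The stationarity of `fuzzyAlpha`. -/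
theorem sum_fuzzyAlpha_mul_avgOp (hd : d ≠ 0) (hQ : IsTransferOperator Q)
    (h : IsPeriodicBoundaryLaw d Q q lam) (g : ZMod q → ℝ) :
    ∑ a, fuzzyAlpha d q lam a * avgOp (stepLaw Q lam) g a =
      ∑ a, fuzzyAlpha d q lam a * g a := by
  obtain ⟨K, hK⟩ := fuzzyAlpha_mul_stepWeight hd hQ h
  have hsum : ∀ a, Summable fun z : ℤ => Q z * (K * lam a * lam (a + z) * g (a + z)) := fun a =>
    summable_mul_periodic hQ (fun z : ℤ => a + (z : ZMod q)) fun b => K * lam a * lam b * g b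
  have hsum' : ∀ a, Summable fun z : ℤ => Q z * (K * lam (a + z) * lam a * g a) := fun a =>
    summable_mul_periodic hQ (fun z : ℤ => a + (z : ZMod q)) fun b => K * lam b * lam a * g a
  have h1 : ∀ a, fuzzyAlpha d q lam a * avgOp (stepLaw Q lam) g a =
      ∑' z : ℤ, Q z * (K * lam a * lam (a + z) * g (a + z)) := fun a => by
    rw [avgOp_stepLaw hQ h.pos, ← tsum_mul_left]
    refine tsum_congr fun z => ?_
    rw [← mul_assoc, hK]
    ring
  have h2 : ∀ a, fuzzyAlpha d q lam a * g a =
      ∑' z : ℤ, Q z * (K * lam (a + z) * lam a * g a) := fun a => by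
    conv_lhs => rw [← mul_one (fuzzyAlpha d q lam a), ← (hasSum_stepWeight hQ h.pos a).tsum_eq,
      ← tsum_mul_left, ← tsum_mul_right]
    refine tsum_congr fun z => ?_
    rw [hK]
    ring
  simp only [h1, h2]
  -- With the class summed first, the reflection of `z` and the translation of `a` by `z` exchange
  -- the two ends of a step.
  rw [← Summable.tsum_finsetSum fun a _ => hsum a, ← Summable.tsum_finsetSum fun a _ => hsum' a,
    ← (Equiv.neg ℤ).tsum_eq]
  refine tsum_congr fun z => ?_
  simp only [Equiv.neg_apply, hQ.symm, Int.cast_neg]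
  rw [← Fintype.sum_equiv (Equiv.addRight (z : ZMod q)) _ _ fun _ => rfl]
  simp

end Step

/-! ### Change of the period, shifts and scalings -/

/-- All fibres of the surjective reduction map have the same size, and the constant function `1`
shows that this size is `r`. -/
theorem sum_castHom {q r : ℕ} [NeZero q] [NeZero r] (f : ZMod q → ℝ) :
    ∑ t : ZMod (q * r), f (ZMod.castHom (dvd_mul_right q r) (ZMod q) t) = r * ∑ t, f t := by
  set φ := ZMod.castHom (dvd_mul_right q r) (ZMod q)
  have hsurj : Function.Surjective φ := ZMod.castHom_surjective _
  have hcard : ∀ b, (Finset.univ.filter fun t => φ t = b).card =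
      (Finset.univ.filter fun t => φ t = 0).card := fun b =>
    AddMonoidHom.card_fiber_eq_of_mem_range φ.toAddMonoidHom (hsurj b) (hsurj 0)
  have hsum : ∀ g : ZMod q → ℝ, ∑ t, g (φ t) =
      (Finset.univ.filter fun t => φ t = 0).card * ∑ b, g b := fun g => by
    rw [← Finset.sum_fiberwise Finset.univ φ, Finset.mul_sum]
    refine Finset.sum_congr rfl fun b _ => ?_
    rw [Finset.sum_congr rfl fun t ht => by rw [(Finset.mem_filter.1 ht).2], Finset.sum_const,
      hcard, nsmul_eq_mul]
  have h1 := hsum fun _ => 1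
  simp only [Finset.sum_const, Finset.card_univ, ZMod.card, nsmul_eq_mul, mul_one,
    Nat.cast_mul] at h1
  have hq : (q : ℝ) ≠ 0 := by exact_mod_cast NeZero.ne q
  rw [hsum, ← mul_right_cancel₀ hq ((mul_comm _ _).trans h1)]

/-- Neither modulus need divide the other, so both sums are pulled back to `ZMod (q * r)`, where the
shift by `a` is a bijection. -/
theorem mul_sum_eq_of_intCast {q r : ℕ} [NeZero q] [NeZero r] {f : ZMod q → ℝ} {g : ZMod r → ℝ}
    {K : ℝ} {a : ℤ} (h : ∀ i : ℤ, g (i : ZMod r) = K * f ((i + a : ℤ) : ZMod q)) :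
    (q : ℝ) * ∑ t, g t = K * (r * ∑ t, f t) := by
  rw [← sum_castHom (q := q) (r := r) f,
    ← Fintype.sum_equiv (Equiv.addRight ((a : ℤ) : ZMod (q * r))) _ _ fun _ => rfl]
  have h2 : ∑ t : ZMod (q * r), g (ZMod.castHom (dvd_mul_left r q) (ZMod r) t) =
      q * ∑ t, g t := by
    rw [← sum_castHom (q := r) (r := q) g]
    refine Fintype.sum_equiv (ZMod.ringEquivCongr (mul_comm q r)).toEquiv _ _ fun t => ?_
    obtain ⟨z, rfl⟩ := ZMod.intCast_surjective t
    simp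
  rw [← h2, Finset.mul_sum]
  refine Finset.sum_congr rfl fun t _ => ?_
  obtain ⟨z, rfl⟩ := ZMod.intCast_surjective t
  have := h z
  simpa using this

/-- `mu` is obtained from `lam` by a shift of the heights and multiplication with `K`; the moduli
of the two periodic functions may differ. -/
def ShiftScaled {q r : ℕ} (lam : ZMod q → ℝ) (mu : ZMod r → ℝ) (K : ℝ) (a : ℤ) : Prop :=
  ∀ i : ℤ, mu (i : ZMod r) = K * lam ((i + a : ℤ) : ZMod q)

section Shift

variable {d q r : ℕ} [NeZero q] [NeZero r] {Q : ℤ → ℝ} {lam : ZMod q → ℝ} {mu : ZMod r → ℝ}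
  {K : ℝ} {a : ℤ}

theorem IsPeriodicBoundaryLaw.shiftScaled (hlam : IsPeriodicBoundaryLaw d Q q lam) (hK : 0 < K)
    (h : ShiftScaled lam mu K a) : IsPeriodicBoundaryLaw d Q r mu := by
  obtain ⟨hpos, hsum, c, hc, heq⟩ := hlam
  have hmul : ∀ i j : ℤ, Q (i - j) * mu (j : ZMod r) =
      K * (Q ((i + a) - (j + a)) * lam ((j + a : ℤ) : ZMod q)) := fun i j => by
    rw [h, add_sub_add_right_eq_sub]; ring
  -- The new constant compensates for the degree of homogeneity: 1 on the left of the equation, `d`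
  -- on the right.
  refine ⟨fun i => ?_, fun i => ?_, K * c / K ^ d, by positivity, fun i => ?_⟩
  · simp only [h i]
    exact mul_pos hK (hpos _)
  · simp only [hmul]
    exact (((Equiv.addRight a).summable_iff).2 (hsum (i + a))).mul_left K
  · simp only [hmul]
    have := (Equiv.addRight a).tsum_eq fun j : ℤ => Q ((i + a) - j) * lam (j : ZMod q)
    simp only [Equiv.coe_addRight] at this
    have heq' : lam ((i + a : ℤ) : ZMod q) = _ := heq (i + a)
    rw [tsum_mul_left, this, h, heq', mul_pow]
    field_simp

theorem ShiftScaled.stepNorm (h : ShiftScaled lam mu K a) (i : ℤ) :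
    stepNorm Q mu (i : ZMod r) = K * stepNorm Q lam ((i + a : ℤ) : ZMod q) := by
  unfold PeriodicGGM.stepNorm
  rw [← tsum_mul_left]
  refine tsum_congr fun z => ?_
  rw [← Int.cast_add, h, ← Int.cast_add, add_right_comm]
  ring

theorem ShiftScaled.stepWeight (h : ShiftScaled lam mu K a) (hK : 0 < K) (i z : ℤ) :
    stepWeight Q mu (i : ZMod r) z = stepWeight Q lam ((i + a : ℤ) : ZMod q) z := by
  unfold PeriodicGGM.stepWeight
  rw [h.stepNorm, ← Int.cast_add, h, ← Int.cast_add, add_right_comm, mul_left_comm,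
    mul_div_mul_left _ _ hK.ne']

/-- Averages against `fuzzyAlpha` are invariant under shifts, scalings and changes of the
period. -/
theorem ShiftScaled.sum_fuzzyAlpha_mul (h : ShiftScaled lam mu K a) (hK : 0 < K)
    (hlam : ∀ i, 0 < lam i) {f : ZMod q → ℝ} {g : ZMod r → ℝ}
    (hfg : ∀ i : ℤ, g (i : ZMod r) = f ((i + a : ℤ) : ZMod q)) :
    ∑ t, fuzzyAlpha d r mu t * g t = ∑ t, fuzzyAlpha d q lam t * f t := by
  set β : ℝ := ((d : ℝ) + 1) / d with hβ
  have hpow : ∀ i : ℤ, mu (i : ZMod r) ^ β = K ^ β * lam ((i + a : ℤ) : ZMod q) ^ β := fun i => by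
    rw [h, Real.mul_rpow hK.le (hlam _).le]
  have h1 := mul_sum_eq_of_intCast (f := fun t => lam t ^ β) (g := fun t => mu t ^ β) hpow
  have h2 := mul_sum_eq_of_intCast (f := fun t => lam t ^ β * f t) (g := fun t => mu t ^ β * g t)
    (K := K ^ β) (a := a) fun i => by rw [hpow, hfg]; ring
  have hl := sum_rpow_pos hlam β
  have hq : (0 : ℝ) < q := by exact_mod_cast Nat.pos_of_ne_zero (NeZero.ne q)
  have hr : (0 : ℝ) < r := by exact_mod_cast Nat.pos_of_ne_zero (NeZero.ne r)
  have hKβ : 0 < K ^ β := Real.rpow_pos_of_pos hK β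
  have e1 : ∑ t, fuzzyAlpha d r mu t * g t = (∑ t, mu t ^ β * g t) / ∑ t, mu t ^ β := by
    rw [Finset.sum_div]
    exact Finset.sum_congr rfl fun t _ => by rw [fuzzyAlpha]; ring
  have e2 : ∑ t, fuzzyAlpha d q lam t * f t = (∑ t, lam t ^ β * f t) / ∑ t, lam t ^ β := by
    rw [Finset.sum_div]
    exact Finset.sum_congr rfl fun t _ => by rw [fuzzyAlpha]; ring
  have hm : 0 < ∑ t, mu t ^ β := by
    have : 0 < (q : ℝ) * ∑ t, mu t ^ β := by rw [h1]; positivity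
    exact pos_of_mul_pos_right this hq.le
  rw [e1, e2, div_eq_div_iff hm.ne' hl.ne']
  refine mul_left_cancel₀ (mul_pos hq (mul_pos hKβ hr)).ne' ?_
  calc _ = (q * ∑ t, mu t ^ β * g t) * (K ^ β * (r * ∑ t, lam t ^ β)) := by ring
    _ = (K ^ β * (r * ∑ t, lam t ^ β * f t)) * (q * ∑ t, mu t ^ β) := by rw [h2, h1]
    _ = _ := by ring

end Shift

section Tree

variable {V : Type*} {G : SimpleGraph V}

/-! ### Rooted trees -/

theorem length_eq_dist_of_isPath (hT : G.IsTree) {u v : V} {p : G.Walk u v} (hp : p.IsPath) :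
    p.length = G.dist u v := by
  obtain ⟨p', hp', hl⟩ := (hT.connected u v).exists_path_of_dist
  have := (hT.isAcyclic.subsingleton_path u v).elim ⟨p, hp⟩ ⟨p', hp'⟩
  rw [← hl, congrArg (fun x : G.Path u v => x.1.length) this]

/-- Both edges extend geodesics from `w` to geodesics ending at `v`; paths in a tree are unique, so
the penultimate vertices agree. -/
theorem eq_of_dist_eq_add_one (hT : G.IsTree) {w u u' v : V} (h : G.Adj u v) (h' : G.Adj u' v)
    (hd : G.dist w v = G.dist w u + 1) (hd' : G.dist w v = G.dist w u' + 1) : u = u' := by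
  obtain ⟨p, -, hl⟩ := (hT.connected w u).exists_path_of_dist
  obtain ⟨p', -, hl'⟩ := (hT.connected w u').exists_path_of_dist
  have h1 : (p.concat h).IsPath :=
    SimpleGraph.Walk.isPath_of_length_eq_dist _ (by rw [SimpleGraph.Walk.length_concat, hl, hd])
  have h2 : (p'.concat h').IsPath :=
    SimpleGraph.Walk.isPath_of_length_eq_dist _ (by rw [SimpleGraph.Walk.length_concat, hl', hd'])
  have h3 := congrArg (fun x : G.Path w v => x.1.penultimate)
    ((hT.isAcyclic.subsingleton_path w v).elim ⟨_, h1⟩ ⟨_, h2⟩)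
  simpa using h3

theorem mem_outwardDarts {L : Finset V} {w : V} {e : (G.induce (L : Set V)).Dart} :
    e ∈ outwardDarts G L w ↔ G.dist w e.snd.1 = G.dist w e.fst.1 + 1 := by
  simp [outwardDarts]

theorem symm_mem_outwardDarts (hT : G.IsTree) {L : Finset V} {w : V}
    {e : (G.induce (L : Set V)).Dart} :
    e.symm ∈ outwardDarts G L w ↔ e ∉ outwardDarts G L w := by
  have hadj : G.Adj e.fst.1 e.snd.1 := e.adj
  have := hT.dist_eq_dist_add_one_of_adj w hadj
  rw [mem_outwardDarts, mem_outwardDarts, SimpleGraph.Dart.symm_toProd, Prod.fst_swap,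
    Prod.snd_swap]
  omega

/-- A path inside `L` is also a path of the tree, hence a geodesic for the distance of `G`; its last
edge therefore points away from `w`. -/
theorem exists_mem_outwardDarts (hT : G.IsTree) {L : Finset V}
    (hL : (G.induce (L : Set V)).Connected) {w v : V} (hw : w ∈ L) (hv : v ∈ L) (hne : v ≠ w) :
    ∃ e ∈ outwardDarts G L w, e.snd.1 = v := by
  obtain ⟨p, hp, -⟩ := (hL ⟨w, hw⟩ ⟨v, hv⟩).exists_path_of_dist
  have hnil : ¬ p.Nil := fun h => hne (congrArg Subtype.val h.eq).symm
  let φ := (SimpleGraph.Embedding.induce (G := G) (L : Set V)).toHom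
  have hφ : Function.Injective φ := Subtype.val_injective
  have h1 := length_eq_dist_of_isPath hT (hp.map hφ)
  have h2 := length_eq_dist_of_isPath hT (hp.dropLast.map hφ)
  rw [SimpleGraph.Walk.length_map] at h1 h2
  refine ⟨⟨(p.penultimate, ⟨v, hv⟩), p.adj_penultimate hnil⟩, mem_outwardDarts.2 ?_, rfl⟩
  have h3 := SimpleGraph.Walk.length_dropLast_add_one hnil
  rw [h1, h2] at h3
  exact h3.symm

open Classical in
/-- The neighbour of `v` on the way to the root `o`. -/
def treeParent (G : SimpleGraph V) (o v : V) : V :=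
  if h : ∃ u, G.Adj u v ∧ G.dist o v = G.dist o u + 1 then h.choose else v

theorem treeParent_eq (hT : G.IsTree) {o u v : V} (h : G.Adj u v)
    (hd : G.dist o v = G.dist o u + 1) : treeParent G o v = u := by
  have hex : ∃ u, G.Adj u v ∧ G.dist o v = G.dist o u + 1 := ⟨u, h, hd⟩
  rw [treeParent, dif_pos hex]
  exact eq_of_dist_eq_add_one hT hex.choose_spec.1 h hex.choose_spec.2 hd

/-- Auxiliary recursion for `treeHeight`, on the distance from the root. -/
def treeHeightAux (G : SimpleGraph V) (o : V) (f : V → ℤ → ℤ) : ℕ → V → ℤ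
  | 0, _ => 0
  | n + 1, v => treeHeightAux G o f n (treeParent G o v) +
      f v (treeHeightAux G o f n (treeParent G o v))

/-- The height function with height `0` at the root `o`, whose increment towards `v` is `f v x` if
the height at the parent of `v` is `x`. -/
def treeHeight (G : SimpleGraph V) (o : V) (f : V → ℤ → ℤ) (v : V) : ℤ :=
  treeHeightAux G o f (G.dist o v) v

theorem treeHeight_root (o : V) (f : V → ℤ → ℤ) : treeHeight G o f o = 0 := by
  rw [treeHeight, SimpleGraph.dist_self, treeHeightAux]

theorem treeHeight_of_adj (hT : G.IsTree) {o u v : V} (f : V → ℤ → ℤ) (h : G.Adj u v)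
    (hd : G.dist o v = G.dist o u + 1) :
    treeHeight G o f v = treeHeight G o f u + f v (treeHeight G o f u) := by
  rw [treeHeight, hd, treeHeightAux, treeParent_eq hT h hd, treeHeight]

open Classical in
/-- The height function with height `0` at `o` and the increments `η` along the edges pointing away
from `o`. -/
def potential (G : SimpleGraph V) (o : V) (η : G.Dart → ℤ) : V → ℤ :=
  treeHeight G o fun v _ =>
    if h : G.Adj (treeParent G o v) v then η ⟨(treeParent G o v, v), h⟩ else 0

theorem eq_potential_sub (hT : G.IsTree) (o : V) (η : G.Dart → ℤ) {e : G.Dart}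
    (he : G.dist o e.snd = G.dist o e.fst + 1) :
    η e = potential G o η e.snd - potential G o η e.fst := by
  obtain ⟨⟨u, v⟩, huv⟩ := e
  have huv' : G.Adj u v := huv
  have hp := treeParent_eq hT huv' he
  rw [potential, treeHeight_of_adj hT _ huv' he]
  subst hp
  simp [huv']

/-- Two functions on a connected part of the tree agree if they agree at a vertex and have the same
increments along the edges pointing away from it. -/
theorem eq_of_outwardDarts (hT : G.IsTree) {A : Type*} {L : Finset V}
    (hL : (G.induce (L : Set V)).Connected) {w : V} (hw : w ∈ L) {σ τ : ↥(L : Set V) → A}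
    (h0 : σ ⟨w, hw⟩ = τ ⟨w, hw⟩)
    (h : ∀ e ∈ outwardDarts G L w, σ e.fst = τ e.fst → σ e.snd = τ e.snd) : σ = τ := by
  suffices H : ∀ n, ∀ v : ↥(L : Set V), G.dist w v.1 = n → σ v = τ v from
    funext fun v => H _ v rfl
  intro n
  induction n with
  | zero =>
    intro v hv
    have : v = ⟨w, hw⟩ := Subtype.ext ((hT.connected.dist_eq_zero_iff).1 hv).symm
    rw [this, h0]
  | succ n ih =>
    intro v hv
    have hne : v.1 ≠ w := by
      rintro hvw
      rw [hvw, SimpleGraph.dist_self] at hv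
      omega
    obtain ⟨e, he, hev⟩ := exists_mem_outwardDarts hT hL hw v.2 hne
    have hv' : e.snd = v := Subtype.ext hev
    rw [← hv']
    refine h e he (ih _ ?_)
    have := mem_outwardDarts.1 he
    rw [hev, hv] at this
    omega

/-- Each vertex of `L` other than the root is the head of exactly one outward edge. -/
theorem prod_outwardDarts_snd {M : Type*} [CommMonoid M] (hT : G.IsTree) {L : Finset V}
    (hL : (G.induce (L : Set V)).Connected) [DecidableEq V] {w : V} (hw : w ∈ L) (g : V → M) :
    ∏ e ∈ outwardDarts G L w, g e.snd.1 = ∏ v ∈ L.erase w, g v := by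
  refine Finset.prod_bij (fun e _ => e.snd.1) (fun e he => ?_) (fun e he e' he' hee => ?_)
    (fun v hv => ?_) fun _ _ => rfl
  · refine Finset.mem_erase.2 ⟨fun h => ?_, e.snd.2⟩
    have := mem_outwardDarts.1 he
    rw [h, SimpleGraph.dist_self] at this
    omega
  · have h1 := mem_outwardDarts.1 he
    have h2 := mem_outwardDarts.1 he'
    rw [← hee] at h2
    have ha : G.Adj e.fst.1 e.snd.1 := e.adj
    have ha' : G.Adj e'.fst.1 e.snd.1 := by rw [hee]; exact e'.adj
    refine SimpleGraph.Dart.ext _ _ (Prod.ext (Subtype.ext ?_) (Subtype.ext hee))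
    exact eq_of_dist_eq_add_one hT ha ha' h1 h2
  · obtain ⟨e, he, hv'⟩ := exists_mem_outwardDarts hT hL hw (Finset.mem_of_mem_erase hv)
      (Finset.ne_of_mem_erase hv)
    exact ⟨e, he, hv'⟩

/-- Moving the root only reverses the orientation of some edges. -/
theorem prod_outwardDarts_of_symm {M : Type*} [CommMonoid M] (hT : G.IsTree) {L : Finset V}
    (w w' : V) {f : (G.induce (L : Set V)).Dart → M} (hf : ∀ e, f e.symm = f e) :
    ∏ e ∈ outwardDarts G L w, f e = ∏ e ∈ outwardDarts G L w', f e := by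
  classical
  refine Finset.prod_bij'
    (fun e _ => if e ∈ outwardDarts G L w' then e else e.symm)
    (fun e _ => if e ∈ outwardDarts G L w then e else e.symm) ?_ ?_ ?_ ?_ ?_
  · intro e _
    split_ifs with h
    exacts [h, (symm_mem_outwardDarts hT).2 h]
  · intro e _
    split_ifs with h
    exacts [h, (symm_mem_outwardDarts hT).2 h]
  · intro e he
    by_cases h : e ∈ outwardDarts G L w'
    · simp [h, he]
    · simp [h, symm_mem_outwardDarts hT, he]
  · intro e he
    by_cases h : e ∈ outwardDarts G L w
    · simp [h, he]
    · simp [h, symm_mem_outwardDarts hT, he]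
  · intro e _
    split_ifs
    exacts [rfl, (hf e).symm]

/-! ### The finite-volume weights in terms of heights -/

/-- The weight of the height increments of `σ` in the volume `L`, computed from the root `w`. -/
def gradWeight (G : SimpleGraph V) (d : ℕ) (Q : ℤ → ℝ) {q : ℕ} [NeZero q] (lam : ZMod q → ℝ)
    (L : Finset V) (w : V) (σ : V → ℤ) : ℝ :=
  ∑ t : ZMod q, fuzzyAlpha d q lam t * ∏ e ∈ outwardDarts G L w,
    stepWeight Q lam (t + ((σ e.fst.1 - σ w : ℤ) : ZMod q)) (σ e.snd.1 - σ e.fst.1)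

section Weight

variable {d q : ℕ} [NeZero q] {Q : ℤ → ℝ} {lam : ZMod q → ℝ}

/-- The indicators in `rho` leave only the fuzzy configurations compatible with the increments, and
such a configuration is determined by its class at the root. -/
theorem ggmWeight_eq_gradWeight (hT : G.IsTree) (hQ : IsTransferOperator Q) {L : Finset V}
    (hL : (G.induce (L : Set V)).Connected) {w : V} (hw : w ∈ L) {zeta : G.Dart → ℤ} {σ : V → ℤ}
    (hσ : ∀ e ∈ outwardDarts G L w, zeta (inclDart G L e) = σ e.snd.1 - σ e.fst.1) :
    ggmWeight G d Q q lam L w hw zeta = gradWeight G d Q lam L w σ := by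
  classical
  unfold ggmWeight gradWeight
  symm
  let emb : ZMod q → ↥(L : Set V) → ZMod q := fun t v => t + ((σ v.1 - σ w : ℤ) : ZMod q)
  have hroot : ∀ t, emb t ⟨w, hw⟩ = t := fun t => by simp [emb]
  refine Fintype.sum_of_injective emb (fun t t' h => ?_) _ _ (fun s hs => ?_) fun t => ?_
  · rw [← hroot t, ← hroot t', h]
  · by_contra hne
    refine hs ⟨s ⟨w, hw⟩, eq_of_outwardDarts hT hL hw (hroot _) fun e he hfst => ?_⟩
    have h1 : rho Q q (zeta (inclDart G L e)) (s e.snd - s e.fst) ≠ 0 := fun h0 =>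
      hne (mul_eq_zero_of_right _ (Finset.prod_eq_zero he h0))
    have h2 : ((zeta (inclDart G L e) : ℤ) : ZMod q) = s e.snd - s e.fst := by
      by_contra h
      exact h1 (if_neg h)
    rw [hσ e he] at h2
    rw [eq_add_of_sub_eq h2.symm, ← hfst]
    simp only [emb]
    push_cast
    ring
  · rw [hroot, mul_assoc, ← Finset.prod_mul_distrib]
    congr 1
    refine Finset.prod_congr rfl fun e he => ?_
    rw [fuzzyP_mul_rho hQ, if_pos, hσ e he]
    rw [hσ e he]
    simp only [emb]
    push_cast
    ring

/-- By detailed balance, the step weight divided by the stationary weight of the head is symmetric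
under edge reversal. Each non-root vertex is the head of one edge and the root carries the initial
law, so what is split off is a product of stationary weights over all of `L`. -/
theorem gradWeight_root_change (hT : G.IsTree) (hd : d ≠ 0) (hQ : IsTransferOperator Q)
    (hlam : IsPeriodicBoundaryLaw d Q q lam) {L : Finset V}
    (hL : (G.induce (L : Set V)).Connected) {w w' : V} (hw : w ∈ L) (hw' : w' ∈ L) (σ : V → ℤ) :
    gradWeight G d Q lam L w σ = gradWeight G d Q lam L w' σ := by
  classical
  let A : ZMod q → V → ℝ := fun t v => fuzzyAlpha d q lam (t + (σ v : ZMod q))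
  have hA : ∀ t v, A t v ≠ 0 := fun t v => (fuzzyAlpha_pos d hlam.pos _).ne'
  let k : ZMod q → (G.induce (L : Set V)).Dart → ℝ := fun t e =>
    stepWeight Q lam (t + (σ e.fst.1 : ZMod q)) (σ e.snd.1 - σ e.fst.1) / A t e.snd.1
  have hk : ∀ t e, k t e.symm = k t e := fun t e => by
    simp only [k, SimpleGraph.Dart.symm_toProd, Prod.fst_swap, Prod.snd_swap]
    rw [div_eq_div_iff (hA _ _) (hA _ _)]
    have := fuzzyAlpha_mul_stepWeight_symm hd hQ hlam (t + (σ e.fst.1 : ZMod q))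
      (σ e.snd.1 - σ e.fst.1)
    have h1 : t + (σ e.fst.1 : ZMod q) + ((σ e.snd.1 - σ e.fst.1 : ℤ) : ZMod q) =
        t + (σ e.snd.1 : ZMod q) := by push_cast; ring
    rw [h1, neg_sub] at this
    simp only [A]
    linarith
  have key : ∀ w ∈ L, gradWeight G d Q lam L w σ =
      ∑ t, (∏ v ∈ L, A t v) * ∏ e ∈ outwardDarts G L w, k t e := by
    intro w hw
    unfold gradWeight
    -- After this translation `t` is the class belonging to height `0` instead of the class at `w`,
    -- a reference that does not depend on the root.
    rw [← Fintype.sum_equiv (Equiv.addRight (σ w : ZMod q)) _ _ fun _ => rfl]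
    refine Finset.sum_congr rfl fun t _ => ?_
    rw [← Finset.mul_prod_erase L _ hw, ← prod_outwardDarts_snd hT hL hw, mul_assoc,
      ← Finset.prod_mul_distrib]
    simp only [Equiv.coe_addRight]
    congr 1
    refine Finset.prod_congr rfl fun e _ => ?_
    rw [mul_div_cancel₀ _ (hA t _)]
    congr 1
    push_cast
    ring
  rw [key w hw, key w' hw']
  refine Finset.sum_congr rfl fun t _ => ?_
  rw [prod_outwardDarts_of_symm hT w w' (hk t)]

theorem gradWeight_shiftScaled {r : ℕ} [NeZero r] {mu : ZMod r → ℝ} {K : ℝ} {a : ℤ}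
    (h : ShiftScaled lam mu K a) (hK : 0 < K) (hlam : ∀ i, 0 < lam i) (L : Finset V) (w : V)
    (σ : V → ℤ) : gradWeight G d Q mu L w σ = gradWeight G d Q lam L w σ := by
  unfold gradWeight
  refine h.sum_fuzzyAlpha_mul hK hlam fun i => Finset.prod_congr rfl fun e _ => ?_
  rw [← Int.cast_add, h.stepWeight hK, ← Int.cast_add, add_right_comm]

theorem IsGGM.shiftScaled (hT : G.IsTree) (hQ : IsTransferOperator Q) {r : ℕ} [NeZero r]
    {mu : ZMod r → ℝ} {K : ℝ} {a : ℤ} (h : ShiftScaled lam mu K a) (hK : 0 < K)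
    (hlam : ∀ i, 0 < lam i) {nu : Measure (G.Dart → ℤ)} (hnu : IsGGM G d Q q lam nu) :
    IsGGM G d Q r mu nu := by
  refine ⟨hnu.prob, hnu.antisymm, fun L w hw hL zeta => ?_⟩
  have hσ' : ∀ e ∈ outwardDarts G L w, zeta (inclDart G L e) =
      potential G w zeta e.snd.1 - potential G w zeta e.fst.1 :=
    fun e he => eq_potential_sub hT w zeta (mem_outwardDarts.1 he)
  rw [hnu.marginal L w hw hL, ggmWeight_eq_gradWeight hT hQ hL hw hσ',
    ggmWeight_eq_gradWeight hT hQ hL hw hσ', gradWeight_shiftScaled h hK hlam]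

end Weight

/-! ### Gradient configurations and their potentials -/

/-- The gradient of a height configuration. -/
def gradConf (G : SimpleGraph V) (σ : V → ℤ) (e : G.Dart) : ℤ := σ e.snd - σ e.fst

theorem gradConf_symm (σ : V → ℤ) (e : G.Dart) : gradConf G σ e.symm = -gradConf G σ e := by
  simp [gradConf]

theorem measurable_gradConf : Measurable (gradConf G) :=
  measurable_pi_lambda _ fun e => (measurable_pi_apply e.snd).sub (measurable_pi_apply e.fst)

theorem measurable_treeHeight {Ω : Type*} [MeasurableSpace Ω] {f : Ω → V → ℤ → ℤ}
    (hf : ∀ v x, Measurable fun ω => f ω v x) (o : V) :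
    Measurable fun ω => treeHeight G o (f ω) := by
  have h : ∀ n v, Measurable fun ω => treeHeightAux G o (f ω) n v := by
    intro n
    induction n with
    | zero => exact fun _ => measurable_const
    | succ n ih =>
      intro v
      have hx := ih (treeParent G o v)
      have hF : Measurable fun y : ℤ × Ω => f y.2 v y.1 :=
        measurable_from_prod_countable_right fun x => hf v x
      exact hx.add (hF.comp (hx.prodMk measurable_id))
  exact measurable_pi_lambda _ fun v => h _ v

theorem measurable_potential (o : V) : Measurable (potential G o) := by
  refine measurable_treeHeight (fun v x => ?_) o
  by_cases h : G.Adj (treeParent G o v) v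
  · simpa only [h, dif_pos] using measurable_pi_apply _
  · simp only [h, dif_neg, not_false_eq_true]
    exact measurable_const

theorem gradConf_potential (hT : G.IsTree) (o : V) {η : G.Dart → ℤ}
    (hη : ∀ e : G.Dart, η e.symm = -η e) : gradConf G (potential G o η) = η := by
  funext e
  rcases hT.dist_eq_dist_add_one_of_adj o e.adj with h | h
  · have h1 := eq_potential_sub hT o η (e := e.symm) (by simpa using h)
    rw [hη] at h1
    simp only [SimpleGraph.Dart.symm_toProd, Prod.fst_swap, Prod.snd_swap] at h1
    rw [gradConf]
    omega
  · exact (eq_potential_sub hT o η h).symm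

/-- The gradient configurations which agree with the gradient of `σ` inside `L`. -/
def heightEvent (G : SimpleGraph V) (L : Finset V) (σ : V → ℤ) : Set (G.Dart → ℤ) :=
  {η | ∀ e : G.Dart, e.fst ∈ L → e.snd ∈ L → η e = σ e.snd - σ e.fst}

theorem measurableSet_heightEvent (L : Finset V) (σ : V → ℤ) :
    MeasurableSet (heightEvent G L σ) := by
  classical
  have h : heightEvent G L σ = ⋂ e : (G.induce (L : Set V)).Dart,
      {η : G.Dart → ℤ | η (inclDart G L e) = σ e.snd.1 - σ e.fst.1} := by
    ext η
    simp only [Set.mem_iInter]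
    exact ⟨fun h e => h (inclDart G L e) e.fst.2 e.snd.2,
      fun h e h1 h2 => h ⟨(⟨e.fst, h1⟩, ⟨e.snd, h2⟩), e.adj⟩⟩
  rw [h]
  exact MeasurableSet.iInter fun e =>
    measurable_pi_apply (inclDart G L e) (measurableSet_singleton _)

theorem mem_heightEvent_iff_outwardDarts (hT : G.IsTree) {L : Finset V} {w : V}
    {zeta η : G.Dart → ℤ} (hη : ∀ e : G.Dart, η e.symm = -η e) {σ : V → ℤ}
    (hσ : ∀ e ∈ outwardDarts G L w, zeta (inclDart G L e) = σ e.snd.1 - σ e.fst.1) :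
    (∀ e ∈ outwardDarts G L w, η (inclDart G L e) = zeta (inclDart G L e)) ↔
      η ∈ heightEvent G L σ := by
  constructor
  · intro h e h1 h2
    let e' : (G.induce (L : Set V)).Dart := ⟨(⟨e.fst, h1⟩, ⟨e.snd, h2⟩), e.adj⟩
    by_cases he : e' ∈ outwardDarts G L w
    · exact (h e' he).trans (hσ e' he)
    · have he' := (symm_mem_outwardDarts hT).2 he
      have h3 : η e.symm = σ e.fst - σ e.snd := (h e'.symm he').trans (hσ e'.symm he')
      rw [hη] at h3
      omega
  · intro h e he
    rw [hσ e he]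
    exact h (inclDart G L e) e.fst.2 e.snd.2

/-- A gradient field has the heights `σ`, up to a constant, on a connected set. -/
theorem gradConf_mem_heightEvent_iff (hT : G.IsTree) {L : Finset V}
    (hL : (G.induce (L : Set V)).Connected) {o : V} (ho : o ∈ L) {τ σ : V → ℤ} (hτ : τ o = 0) :
    gradConf G τ ∈ heightEvent G L σ ↔ ∀ v ∈ L, τ v = σ v - σ o := by
  constructor
  · intro h
    have : (fun v : ↥(L : Set V) => τ v.1) = fun v : ↥(L : Set V) => σ v.1 - σ o := by
      refine eq_of_outwardDarts hT hL ho (by simp [hτ]) fun e _ h1 => ?_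
      have h2 : τ e.snd.1 - τ e.fst.1 = σ e.snd.1 - σ e.fst.1 :=
        h (inclDart G L e) e.fst.2 e.snd.2
      change τ e.snd.1 = σ e.snd.1 - σ o
      change τ e.fst.1 = σ e.fst.1 - σ o at h1
      omega
    exact fun v hv => congrFun this ⟨v, hv⟩
  · intro h e h1 h2
    rw [gradConf, h _ h1, h _ h2]
    ring

theorem potential_root (o : V) (η : G.Dart → ℤ) : potential G o η o = 0 := treeHeight_root _ _

/-! ### Finite-volume marginals as probabilities of height events -/

section Law

variable {d q : ℕ} [NeZero q] {Q : ℤ → ℝ} {lam : ZMod q → ℝ}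

theorem IsGGM.measure_heightEvent (hT : G.IsTree) (hQ : IsTransferOperator Q)
    {nu : Measure (G.Dart → ℤ)} (hnu : IsGGM G d Q q lam nu) {L : Finset V}
    (hL : (G.induce (L : Set V)).Connected) {w : V} (hw : w ∈ L) (σ : V → ℤ) :
    nu (heightEvent G L σ) = ENNReal.ofReal (gradWeight G d Q lam L w σ) := by
  have hσ : ∀ e ∈ outwardDarts G L w, gradConf G σ (inclDart G L e) =
      σ e.snd.1 - σ e.fst.1 := fun e _ => rfl
  rw [← ggmWeight_eq_gradWeight hT hQ hL hw hσ, ← hnu.marginal L w hw hL]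
  refine measure_congr ?_
  filter_upwards [hnu.antisymm] with η hη
  exact propext (mem_heightEvent_iff_outwardDarts hT hη hσ).symm

theorem IsGGM.of_heightEvent (hT : G.IsTree) (hQ : IsTransferOperator Q)
    {nu : Measure (G.Dart → ℤ)} (hprob : IsProbabilityMeasure nu)
    (hanti : ∀ᵐ η ∂nu, ∀ e : G.Dart, η e.symm = -η e)
    (h : ∀ (L : Finset V), (G.induce (L : Set V)).Connected → ∀ w ∈ L, ∀ σ : V → ℤ,
      nu (heightEvent G L σ) = ENNReal.ofReal (gradWeight G d Q lam L w σ)) :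
    IsGGM G d Q q lam nu := by
  refine ⟨hprob, hanti, fun L w hw hL zeta => ?_⟩
  have hσ : ∀ e ∈ outwardDarts G L w, zeta (inclDart G L e) =
      potential G w zeta e.snd.1 - potential G w zeta e.fst.1 :=
    fun e he => eq_potential_sub hT w zeta (mem_outwardDarts.1 he)
  rw [ggmWeight_eq_gradWeight hT hQ hL hw hσ, ← h L hL w hw]
  refine measure_congr ?_
  filter_upwards [hanti] with η hη
  exact propext (mem_heightEvent_iff_outwardDarts hT hη hσ)

end Law

/-! ### Uniqueness of the gradient measure, and countability of the tree -/

theorem exists_connected_superset (hT : G.IsTree) {J : Finset V} (hJ : J.Nonempty) :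
    ∃ L : Finset V, J ⊆ L ∧ (G.induce (L : Set V)).Connected :=
  SimpleGraph.extend_finset_to_connected hT.connected.preconnected hJ

/-- A law of gradient configurations is determined by its values on the height events of the
connected volumes which contain two given vertices. -/
theorem measure_ext_of_heightEvent (hT : G.IsTree) {nu nu' : Measure (G.Dart → ℤ)}
    [IsProbabilityMeasure nu] [IsProbabilityMeasure nu']
    (ha : ∀ᵐ η ∂nu, ∀ e : G.Dart, η e.symm = -η e)
    (ha' : ∀ᵐ η ∂nu', ∀ e : G.Dart, η e.symm = -η e) (o w : V)
    (h : ∀ L : Finset V, (G.induce (L : Set V)).Connected → o ∈ L → w ∈ L → ∀ σ : V → ℤ,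
      nu (heightEvent G L σ) = nu' (heightEvent G L σ)) : nu = nu' := by
  classical
  have hpm := measurable_potential (G := G) o
  have hrec : ∀ mu : Measure (G.Dart → ℤ), (∀ᵐ η ∂mu, ∀ e : G.Dart, η e.symm = -η e) →
      (mu.map (potential G o)).map (gradConf G) = mu := by
    intro mu hmu
    rw [Measure.map_map measurable_gradConf hpm]
    refine (Measure.map_congr (g := id) ?_).trans Measure.map_id
    filter_upwards [hmu] with η hη
    exact gradConf_potential hT o hη
  have hset : ∀ (mu : Measure (G.Dart → ℤ)), (∀ᵐ η ∂mu, ∀ e : G.Dart, η e.symm = -η e) →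
      ∀ L : Finset V, (G.induce (L : Set V)).Connected → o ∈ L → ∀ σ : V → ℤ, σ o = 0 →
        mu {η | ∀ v ∈ L, potential G o η v = σ v} = mu (heightEvent G L σ) := by
    intro mu hmu L hL ho σ hσ
    refine measure_congr ?_
    filter_upwards [hmu] with η hη
    have := gradConf_mem_heightEvent_iff hT hL ho (σ := σ) (potential_root o η)
    rw [gradConf_potential hT o hη, hσ] at this
    simp only [sub_zero] at this
    exact propext this.symm
  -- An antisymmetric gradient field is recovered from its potential, so it suffices to compare laws
  -- on `V → ℤ`, which are determined by their finite-dimensional marginals.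
  suffices hmap : nu.map (potential G o) = nu'.map (potential G o) by
    rw [← hrec nu ha, ← hrec nu' ha', hmap]
  have : IsProbabilityMeasure (nu'.map (potential G o)) :=
    Measure.isProbabilityMeasure_map hpm.aemeasurable
  have hfin : ∀ J : Finset V, IsFiniteMeasure ((nu'.map (potential G o)).map J.restrict) :=
    fun J => inferInstance
  refine IsProjectiveLimit.unique
    (P := fun J : Finset V => (nu'.map (potential G o)).map J.restrict) (fun J => ?_) fun _ => rfl
  beta_reduce
  obtain ⟨L, hJL, hL⟩ := exists_connected_superset hT (J := J ∪ {o, w}) ⟨o, by simp⟩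
  have hoL : o ∈ L := hJL (by simp)
  have hwL : w ∈ L := hJL (by simp)
  have hJ : J ⊆ L := Finset.subset_union_left.trans hJL
  have hfac : (J.restrict : (V → ℤ) → _) = Finset.restrict₂ hJ ∘ L.restrict := rfl
  rw [hfac, ← Measure.map_map (Finset.measurable_restrict₂ hJ) (Finset.measurable_restrict L),
    ← Measure.map_map (Finset.measurable_restrict₂ hJ) (Finset.measurable_restrict L)]
  congr 1
  refine Measure.ext_of_singleton fun b => ?_
  rw [Measure.map_apply (Finset.measurable_restrict L) (measurableSet_singleton b),
    Measure.map_apply (Finset.measurable_restrict L) (measurableSet_singleton b),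
    Measure.map_apply hpm (Finset.measurable_restrict L (measurableSet_singleton b)),
    Measure.map_apply hpm (Finset.measurable_restrict L (measurableSet_singleton b))]
  -- Potentials vanish at `o`, so any other prescribed value there gives the empty event.
  by_cases hb : b ⟨o, hoL⟩ = 0
  · let σ : V → ℤ := fun v => if hv : v ∈ L then b ⟨v, hv⟩ else 0
    have hσ : σ o = 0 := by simp only [σ, dif_pos hoL, hb]
    have hS : potential G o ⁻¹' (L.restrict ⁻¹' {b}) = {η | ∀ v ∈ L, potential G o η v = σ v} := by
      ext η
      simp only [Set.mem_preimage, Set.mem_singleton_iff, Set.mem_ofPred_eq, funext_iff,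
        Finset.restrict, Subtype.forall]
      refine forall₂_congr fun v hv => ?_
      simp only [σ, dif_pos hv]
    rw [hS, hset nu ha L hL hoL σ hσ, hset nu' ha' L hL hoL σ hσ]
    exact h L hL hoL hwL σ
  · have hS : potential G o ⁻¹' (L.restrict ⁻¹' {b}) = ∅ := by
      refine Set.eq_empty_of_forall_notMem fun η hη => hb ?_
      have := congrFun (Set.mem_singleton_iff.1 hη) ⟨o, hoL⟩
      rw [← this]
      exact potential_root o η
    rw [hS, measure_empty, measure_empty]

theorem countable_of_connected_locallyFinite [G.LocallyFinite] (hG : G.Connected) :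
    Countable V := by
  obtain ⟨o⟩ := hG.nonempty
  have h : ∀ n, {v | G.dist o v = n}.Countable := by
    intro n
    induction n with
    | zero =>
      refine (Set.countable_singleton o).mono fun v hv => ?_
      exact ((hG.dist_eq_zero_iff).1 hv).symm
    | succ n ih =>
      refine (ih.biUnion fun u _ => (Set.toFinite (G.neighborSet u)).countable).mono fun v hv => ?_
      obtain ⟨p, hp, hl⟩ := (hG o v).exists_path_of_dist
      rw [Set.mem_ofPred_eq] at hv
      have hnil : ¬ p.Nil := fun hn => by
        rw [hn.eq, SimpleGraph.dist_self] at hv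
        omega
      have h1 := SimpleGraph.Walk.length_dropLast_add_one hnil
      have h2 := SimpleGraph.dist_le p.dropLast
      have h3 := (hG.dist_triangle (u := o) (v := p.penultimate) (w := v))
      rw [SimpleGraph.dist_eq_one_iff_adj.2 (p.adj_penultimate hnil)] at h3
      exact Set.mem_biUnion (x := p.penultimate) (show G.dist o p.penultimate = n by omega)
        (p.adj_penultimate hnil)
  have hU : (Set.univ : Set V) ⊆ ⋃ n, {v | G.dist o v = n} := fun v _ =>
    Set.mem_iUnion.2 ⟨_, rfl⟩
  exact Set.countable_univ_iff.1 ((Set.countable_iUnion h).mono hU)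

/-! ### Construction of the gradient measure from a root -/

section Construction

variable {d q : ℕ} [NeZero q] {Q : ℤ → ℝ} {lam : ZMod q → ℝ}

/-- The law of the innovations: for every vertex and every residue class an independent integer
increment. -/
def innovationLaw (V : Type*) (Q : ℤ → ℝ) {q : ℕ} [NeZero q] (lam : ZMod q → ℝ)
    [∀ c, IsProbabilityMeasure (stepLaw Q lam c)] : Measure (V → ZMod q → ℤ) :=
  Measure.infinitePi fun _ : V => Measure.pi (stepLaw Q lam)

instance [∀ c, IsProbabilityMeasure (stepLaw Q lam c)] :
    IsProbabilityMeasure (innovationLaw V Q lam) :=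
  inferInstanceAs (IsProbabilityMeasure (Measure.infinitePi _))

/-- The heights generated by the innovations `ω`, if the class at the root `o` is `s`. -/
def rootedHeight (G : SimpleGraph V) (o : V) (s : ZMod q) (ω : V → ZMod q → ℤ) : V → ℤ :=
  treeHeight G o fun v x => ω v (s + (x : ZMod q))

theorem measurable_rootedHeight (o : V) (s : ZMod q) : Measurable (rootedHeight G o s) :=
  measurable_treeHeight
    (fun v x => (measurable_pi_apply (s + (x : ZMod q))).comp (measurable_pi_apply v)) o

/-- The gradient measure built from the root `o`. -/
def rootedGGM (G : SimpleGraph V) (d : ℕ) (Q : ℤ → ℝ) {q : ℕ} [NeZero q] (lam : ZMod q → ℝ)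
    [∀ c, IsProbabilityMeasure (stepLaw Q lam c)] (o : V) : Measure (G.Dart → ℤ) :=
  ∑ s : ZMod q, ENNReal.ofReal (fuzzyAlpha d q lam s) •
    (innovationLaw V Q lam).map fun ω => gradConf G (rootedHeight G o s ω)

variable [∀ c, IsProbabilityMeasure (stepLaw Q lam c)]

theorem measurable_gradConf_rootedHeight (o : V) (s : ZMod q) :
    Measurable fun ω => gradConf G (rootedHeight G o s ω) :=
  measurable_gradConf.comp (measurable_rootedHeight o s)

theorem isProbabilityMeasure_rootedGGM (hlam : ∀ i, 0 < lam i) (o : V) :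
    IsProbabilityMeasure (rootedGGM G d Q lam o) := by
  refine ⟨?_⟩
  rw [rootedGGM, Measure.finsetSum_apply]
  have : ∀ s : ZMod q, (innovationLaw V Q lam).map (fun ω => gradConf G (rootedHeight G o s ω))
      Set.univ = 1 := fun s => by
    rw [Measure.map_apply (measurable_gradConf_rootedHeight o s) MeasurableSet.univ]
    simp
  simp only [Measure.smul_apply, this, smul_eq_mul, mul_one]
  rw [← ENNReal.ofReal_sum_of_nonneg fun i _ => (fuzzyAlpha_pos d hlam i).le,
    sum_fuzzyAlpha d hlam, ENNReal.ofReal_one]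

theorem ae_rootedGGM {o : V} {p : (G.Dart → ℤ) → Prop} (hp : MeasurableSet {η | p η})
    (h : ∀ s : ZMod q, ∀ᵐ ω ∂innovationLaw V Q lam, p (gradConf G (rootedHeight G o s ω))) :
    ∀ᵐ η ∂rootedGGM G d Q lam o, p η := by
  rw [ae_iff, rootedGGM, Measure.finsetSum_apply]
  refine Finset.sum_eq_zero fun s _ => ?_
  have h1 := (ae_map_iff (measurable_gradConf_rootedHeight o s).aemeasurable hp).2 (h s)
  rw [Measure.smul_apply, ae_iff.1 h1, smul_zero]

theorem rootedGGM_antisymm [Countable V] (o : V) :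
    ∀ᵐ η ∂rootedGGM G d Q lam o, ∀ e : G.Dart, η e.symm = -η e := by
  have : Countable G.Dart := SimpleGraph.Dart.toProd_injective.countable
  exact ae_all_iff.2 fun e => ae_rootedGGM
    (measurableSet_eq_fun (measurable_pi_apply _) (measurable_pi_apply _).neg)
    fun s => ae_of_all _ fun ω => gradConf_symm _ e

/-- Working outwards from the root, the event fixes for each `v ≠ o` in `L` one coordinate of the
innovation at `v`, namely the one at the class that `σ` dictates for its parent. Independence gives
the product. -/
theorem innovationLaw_heightEvent (hT : G.IsTree) (hQ : IsTransferOperator Q)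
    (hlam : ∀ i, 0 < lam i) {L : Finset V} (hL : (G.induce (L : Set V)).Connected) {o : V}
    (ho : o ∈ L) (s : ZMod q) (σ : V → ℤ) :
    innovationLaw V Q lam {ω | gradConf G (rootedHeight G o s ω) ∈ heightEvent G L σ} =
      ENNReal.ofReal (∏ e ∈ outwardDarts G L o,
        stepWeight Q lam (s + ((σ e.fst.1 - σ o : ℤ) : ZMod q)) (σ e.snd.1 - σ e.fst.1)) := by
  classical
  let c : V → ZMod q := fun v => s + ((σ (treeParent G o v) - σ o : ℤ) : ZMod q)
  let z : V → ℤ := fun v => σ v - σ (treeParent G o v)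
  have hpar : ∀ e ∈ outwardDarts G L o, treeParent G o e.snd.1 = e.fst.1 := fun e he =>
    treeParent_eq hT e.adj (mem_outwardDarts.1 he)
  have hset : {ω | gradConf G (rootedHeight G o s ω) ∈ heightEvent G L σ} =
      ((L.erase o : Finset V) : Set V).pi fun v => {t : ZMod q → ℤ | t (c v) = z v} := by
    ext ω
    have hstep : ∀ e ∈ outwardDarts G L o, rootedHeight G o s ω e.snd.1 =
        rootedHeight G o s ω e.fst.1 +
          ω e.snd.1 (s + (rootedHeight G o s ω e.fst.1 : ZMod q)) := fun e he =>
      treeHeight_of_adj hT _ e.adj (mem_outwardDarts.1 he)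
    rw [Set.mem_ofPred_eq, gradConf_mem_heightEvent_iff hT hL ho
      (show rootedHeight G o s ω o = 0 from treeHeight_root _ _)]
    simp only [Set.mem_pi, Finset.mem_coe, Set.mem_ofPred_eq]
    constructor
    · intro h v hv
      obtain ⟨e, he, rfl⟩ := exists_mem_outwardDarts hT hL ho (Finset.mem_of_mem_erase hv)
        (Finset.ne_of_mem_erase hv)
      have h1 := hstep e he
      rw [h _ e.snd.2, h _ e.fst.2] at h1
      simp only [c, z, hpar e he]
      omega
    · intro h
      have : (fun v : ↥(L : Set V) => rootedHeight G o s ω v.1) =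
          fun v : ↥(L : Set V) => σ v.1 - σ o := by
        refine eq_of_outwardDarts hT hL ho ?_ fun e he h1 => ?_
        · simp only [sub_self]
          exact treeHeight_root _ _
        · change rootedHeight G o s ω e.fst.1 = σ e.fst.1 - σ o at h1
          have hne : e.snd.1 ≠ o := by
            intro h0
            have := mem_outwardDarts.1 he
            rw [h0, SimpleGraph.dist_self] at this
            omega
          have h2 := h e.snd.1 (Finset.mem_erase.2 ⟨hne, e.snd.2⟩)
          simp only [c, z, hpar e he] at h2
          rw [hstep e he, h1, h2]
          ring
      exact fun v hv => congrFun this ⟨v, hv⟩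
  have hcoord : ∀ v, Measure.pi (stepLaw Q lam) {t : ZMod q → ℤ | t (c v) = z v} =
      ENNReal.ofReal (stepWeight Q lam (c v) (z v)) := fun v => by
    rw [← stepLaw_singleton]
    exact (measurePreserving_eval (stepLaw Q lam) (c v)).measure_preimage
      (measurableSet_singleton (z v)).nullMeasurableSet
  rw [hset, innovationLaw, Measure.infinitePi_pi _ fun _ _ => MeasurableSet.of_discrete]
  simp only [hcoord]
  rw [← prod_outwardDarts_snd hT hL ho,
    ENNReal.ofReal_prod_of_nonneg fun e _ => (stepWeight_pos hQ hlam _ _).le]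
  refine Finset.prod_congr rfl fun e he => ?_
  simp only [c, z, hpar e he]

theorem rootedGGM_heightEvent (hT : G.IsTree) (hQ : IsTransferOperator Q)
    (hlam : ∀ i, 0 < lam i) {L : Finset V} (hL : (G.induce (L : Set V)).Connected) {o : V}
    (ho : o ∈ L) (σ : V → ℤ) : rootedGGM G d Q lam o (heightEvent G L σ) =
      ENNReal.ofReal (gradWeight G d Q lam L o σ) := by
  rw [rootedGGM, Measure.finsetSum_apply, gradWeight,
    ENNReal.ofReal_sum_of_nonneg fun t _ => mul_nonneg (fuzzyAlpha_pos d hlam t).le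
      (Finset.prod_nonneg fun e _ => (stepWeight_pos hQ hlam _ _).le)]
  refine Finset.sum_congr rfl fun s _ => ?_
  rw [Measure.smul_apply, Measure.map_apply (measurable_gradConf_rootedHeight o s)
    (measurableSet_heightEvent L σ), ENNReal.ofReal_mul (fuzzyAlpha_pos d hlam s).le,
    smul_eq_mul, ← innovationLaw_heightEvent hT hQ hlam hL ho s σ]
  rfl

/-- The construction computes marginals only in volumes containing its own root. The constructions
from `o` and `w` agree on volumes containing both, hence coincide, and the one from `w` treats every
volume around `w`. -/
theorem isGGM_rootedGGM [Countable V] (hT : G.IsTree) (hd : d ≠ 0) (hQ : IsTransferOperator Q)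
    (hlam : IsPeriodicBoundaryLaw d Q q lam) (o : V) :
    IsGGM G d Q q lam (rootedGGM G d Q lam o) := by
  have := fun v => isProbabilityMeasure_rootedGGM (G := G) (d := d) (Q := Q) hlam.pos v
  refine IsGGM.of_heightEvent hT hQ (this o) (rootedGGM_antisymm o) fun L hL w hw σ => ?_
  have heq : rootedGGM G d Q lam o = rootedGGM G d Q lam w := by
    refine measure_ext_of_heightEvent hT (rootedGGM_antisymm o) (rootedGGM_antisymm w) o w
      fun L hL ho hw σ => ?_
    rw [rootedGGM_heightEvent hT hQ hlam.pos hL ho, rootedGGM_heightEvent hT hQ hlam.pos hL hw,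
      gradWeight_root_change hT hd hQ hlam hL ho hw]
  rw [heq, rootedGGM_heightEvent hT hQ hlam.pos hL hw]

end Construction

theorem IsGGM.unique (hT : G.IsTree) {d q : ℕ} [NeZero q] {Q : ℤ → ℝ}
    {lam : ZMod q → ℝ} (hQ : IsTransferOperator Q) {nu nu' : Measure (G.Dart → ℤ)}
    (h : IsGGM G d Q q lam nu) (h' : IsGGM G d Q q lam nu') : nu = nu' := by
  have := h.prob
  have := h'.prob
  obtain ⟨o⟩ := hT.connected.nonempty
  refine measure_ext_of_heightEvent hT h.antisymm h'.antisymm o o fun L hL ho _ σ => ?_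
  rw [h.measure_heightEvent hT hQ hL ho, h'.measure_heightEvent hT hQ hL ho]

/-! ### Empirical distributions along a path -/

theorem empirical_eq_sum (r : ℕ) (a : ℕ → ℤ) (n : ℕ) (k : ZMod r) :
    empirical r a n k =
      (∑ i ∈ Finset.range (n + 1), if (a i : ZMod r) = k then (1 : ℝ) else 0) / ((n : ℝ) + 1) := by
  rw [empirical, Finset.card_filter]
  push_cast
  rfl

/-- If the distance dropped after `n + 1`, the vertices `n` and `n + 2` would both be the parent of
vertex `n + 1`, contradicting self-avoidance. -/
theorem InfinitePath.dist_succ (hT : G.IsTree) (x : InfinitePath G) (n : ℕ) :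
    G.dist (x.vert 0) (x.vert (n + 1)) = G.dist (x.vert 0) (x.vert n) + 1 := by
  induction n with
  | zero => rw [SimpleGraph.dist_eq_one_iff_adj.2 (x.adj 0), SimpleGraph.dist_self]
  | succ n ih =>
    rcases hT.dist_eq_dist_add_one_of_adj (x.vert 0) (x.adj (n + 1)) with h | h
    · have := x.inj (eq_of_dist_eq_add_one hT (x.adj n) (x.adj (n + 1)).symm ih h)
      omega
    · exact h

theorem InfinitePath.measurable_height (x : InfinitePath G) (m : ℕ) (h : ℤ) (n : ℕ) :
    Measurable fun η => x.height m h η n := by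
  have hs : ∀ n, Measurable fun η => ∑ k ∈ Finset.range n, x.increment η k := fun n =>
    Finset.measurable_sum _ fun k _ => measurable_pi_apply _
  exact ((hs n).const_add h).sub (hs m)

theorem InfinitePath.height_gradConf (x : InfinitePath G) (m : ℕ) (h : ℤ) (σ : V → ℤ) (n : ℕ) :
    x.height m h (gradConf G σ) n = h + σ (x.vert n) - σ (x.vert m) := by
  have hs : ∀ n, ∑ k ∈ Finset.range n, x.increment (gradConf G σ) k =
      σ (x.vert n) - σ (x.vert 0) := fun n =>
    Finset.sum_range_sub (fun k => σ (x.vert k)) n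
  rw [InfinitePath.height, hs, hs]
  ring

theorem measurable_empirical_height (x : InfinitePath G) (m : ℕ) (h : ℤ) (r n : ℕ) (k : ZMod r) :
    Measurable fun η => empirical r (x.height m h η) n k := by
  simp only [empirical_eq_sum]
  refine (Finset.measurable_sum _ fun i _ => ?_).div_const _
  exact (Measurable.of_discrete (f := fun z : ℤ => if (z : ZMod r) = k then (1 : ℝ) else 0)).comp
    (x.measurable_height m h i)

section Limit

variable {d N : ℕ} [NeZero N] {Q : ℤ → ℝ} {lam : ZMod N → ℝ}

theorem rootedHeight_path (hT : G.IsTree) (x : InfinitePath G) (s : ZMod N)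
    (ω : V → ZMod N → ℤ) (n : ℕ) : rootedHeight G (x.vert 0) s ω (x.vert n) =
      drivenWalk s (fun k => ω (x.vert (k + 1))) n := by
  induction n with
  | zero => exact treeHeight_root _ _
  | succ n ih =>
    rw [drivenWalk, ← ih]
    exact treeHeight_of_adj hT _ (x.adj n) (x.dist_succ hT n)

theorem ae_tendsto_empirical_rootedHeight (hT : G.IsTree) (hd : d ≠ 0)
    (hQ : IsTransferOperator Q) (hlam : IsPeriodicBoundaryLaw d Q N lam)
    [∀ c, IsProbabilityMeasure (stepLaw Q lam c)] (x : InfinitePath G) (m : ℕ) (h : ℤ)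
    (s : ZMod N) : ∀ᵐ ω ∂innovationLaw V Q lam, ∃ c : ZMod N, ∀ k, Tendsto (fun n => empirical N
      (x.height m h (gradConf G (rootedHeight G (x.vert 0) s ω))) n k) atTop
        (𝓝 (fuzzyAlpha d N lam (k + c))) := by
  have hα := sum_fuzzyAlpha d hlam.pos
  have hi : iIndepFun (fun (n : ℕ) (ω : V → ZMod N → ℤ) => ω (x.vert (n + 1)))
      (innovationLaw V Q lam) :=
    iIndepFun.precomp (g := fun n => x.vert (n + 1))
      (fun a b hab => by have := x.inj hab; omega)
      (iIndepFun_infinitePi (X := fun _ => id) fun _ => measurable_id)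
  have hlaw : ∀ (n : ℕ) c, (innovationLaw V Q lam).map
      (fun ω : V → ZMod N → ℤ => ω (x.vert (n + 1)) c) = stepLaw Q lam c := fun n c =>
    ((measurePreserving_eval (stepLaw Q lam) c).comp
      (measurePreserving_eval_infinitePi (fun _ : V => Measure.pi (stepLaw Q lam))
        (x.vert (n + 1)))).map_eq
  have hpos : ∀ (c : ZMod N) z, stepLaw Q lam c {z} ≠ 0 := fun c z => by
    rw [stepLaw_singleton]
    exact (ENNReal.ofReal_pos.2 (stepWeight_pos hQ hlam.pos c z)).ne'
  have hf : ∀ k : ZMod N, ∑ a, fuzzyAlpha d N lam a *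
      ((if a = k then 1 else 0) - fuzzyAlpha d N lam k) = 0 := fun k => by
    simp only [mul_sub, Finset.sum_sub_distrib, ← Finset.sum_mul, hα]
    simp
  have hlln := fun k => ae_tendsto_average_drivenWalk (stepLaw Q lam) hpos hα
    (sum_fuzzyAlpha_mul_avgOp hd hQ hlam) (fun n => measurable_pi_apply (x.vert (n + 1))) hi hlaw s
    (hf k)
  filter_upwards [ae_all_iff.2 hlln] with ω hω
  set u : ℕ → ZMod N → ℤ := fun k => ω (x.vert (k + 1))
  -- The chain is in class `s + drivenWalk`, while heights are normalised to `h` at index `m`; this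
  -- offset translates one into the other and is the only randomness left in the limit.
  refine ⟨s + (drivenWalk s u m : ℤ) - h, fun k => ?_⟩
  set l := k + (s + (drivenWalk s u m : ℤ) - h)
  have h1 := ((hω l).comp (tendsto_add_atTop_nat 1)).add_const (fuzzyAlpha d N lam l)
  rw [zero_add] at h1
  refine h1.congr fun n => ?_
  rw [empirical_eq_sum]
  have h2 : ∀ i, (if ((x.height m h (gradConf G (rootedHeight G (x.vert 0) s ω)) i : ℤ) :
      ZMod N) = k then (1 : ℝ) else 0) = if s + (drivenWalk s u i : ℤ) = l then 1 else 0 := by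
    intro i
    rw [x.height_gradConf, rootedHeight_path hT, rootedHeight_path hT]
    refine if_congr ?_ rfl rfl
    simp only [l]
    push_cast
    constructor
    · rintro rfl
      ring
    · intro h3
      linear_combination h3
  have hn : (n : ℝ) + 1 ≠ 0 := by positivity
  simp only [h2, Function.comp_apply, Finset.sum_sub_distrib, Finset.sum_const, Finset.card_range,
    nsmul_eq_mul]
  push_cast
  field_simp
  ring

/-- Uniqueness allows the measure to be realised with its root at the start of the path, where the
heights are a driven walk. -/
theorem isEmpiricalLimit_fuzzyAlpha [Countable V] (hT : G.IsTree) (hd : d ≠ 0)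
    (hQ : IsTransferOperator Q) (hlam : IsPeriodicBoundaryLaw d Q N lam)
    {nu : Measure (G.Dart → ℤ)} (hnu : IsGGM G d Q N lam nu) (x : InfinitePath G) (m : ℕ)
    (h : ℤ) : IsEmpiricalLimit nu x m h N (fuzzyAlpha d N lam) := by
  refine ⟨fuzzyAlpha_mem_stdSimplex d hlam.pos, ?_⟩
  have := isProbabilityMeasure_stepLaw hQ hlam.pos
  rw [hnu.unique hT hQ (isGGM_rootedGGM hT hd hQ hlam (x.vert 0))]
  have hae : ∀ᵐ η ∂rootedGGM G d Q lam (x.vert 0), ∃ c : ZMod N, ∀ k, Tendsto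
      (fun n => empirical N (x.height m h η) n k) atTop (𝓝 (fuzzyAlpha d N lam (k + c))) := by
    refine ae_rootedGGM ?_ fun s => ae_tendsto_empirical_rootedHeight hT hd hQ hlam x m h s
    simp only [Set.ofPred_exists, Set.ofPred_forall]
    exact MeasurableSet.iUnion fun c => MeasurableSet.iInter fun k =>
      measurableSet_tendsto _ fun n => measurable_empirical_height x m h N n k
  filter_upwards [hae] with η hη
  obtain ⟨c, hc⟩ := hη
  exact ⟨fun k => fuzzyAlpha d N lam (k + c), ⟨c, fun _ => rfl⟩, tendsto_pi_nhds.2 hc⟩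

end Limit

/-- The limit of the empirical distributions modulo a divisor. -/
theorem IsEmpiricalLimit.castHom {N r : ℕ} [NeZero N] [NeZero r] (hr : r ∣ N)
    {nu : Measure (G.Dart → ℤ)} {x : InfinitePath G} {m : ℕ} {h : ℤ} {α : ZMod N → ℝ}
    (hα : IsEmpiricalLimit nu x m h N α) : IsEmpiricalLimit nu x m h r
      fun k => ∑ t, if ZMod.castHom hr (ZMod r) t = k then α t else 0 := by
  obtain ⟨⟨hnonneg, hsum⟩, hae⟩ := hα
  refine ⟨⟨fun k => Finset.sum_nonneg fun t _ => ?_, ?_⟩, ?_⟩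
  · split_ifs
    exacts [hnonneg t, le_rfl]
  · rw [Finset.sum_comm]
    simp only [Finset.sum_ite_eq, Finset.mem_univ, if_true]
    exact hsum
  · filter_upwards [hae] with η hη
    obtain ⟨a, ⟨s, hs⟩, ha⟩ := hη
    refine ⟨fun k => ∑ t, if ZMod.castHom hr (ZMod r) t = k then a t else 0,
      ⟨ZMod.castHom hr (ZMod r) s, fun k => ?_⟩, ?_⟩
    · refine Fintype.sum_equiv (Equiv.addRight s) _ _ fun t => ?_
      simp only [Equiv.coe_addRight, map_add, add_left_inj, hs]
    · refine tendsto_pi_nhds.2 fun k => ?_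
      have h1 : Tendsto (fun n => ∑ t, if ZMod.castHom hr (ZMod r) t = k then
          empirical N (x.height m h η) n t else 0) atTop
          (𝓝 (∑ t, if ZMod.castHom hr (ZMod r) t = k then a t else 0)) := by
        refine tendsto_finsetSum _ fun t _ => ?_
        split_ifs
        exacts [tendsto_pi_nhds.1 ha t, tendsto_const_nhds]
      refine h1.congr fun n => ?_
      simp only [empirical_eq_sum]
      have h2 : ∀ t : ZMod N, (if ZMod.castHom hr (ZMod r) t = k then
          (∑ i ∈ Finset.range (n + 1), if (x.height m h η i : ZMod N) = t then (1 : ℝ) else 0) /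
            ((n : ℝ) + 1) else 0) =
          (∑ i ∈ Finset.range (n + 1), if (x.height m h η i : ZMod N) = t then
            (if ZMod.castHom hr (ZMod r) t = k then (1 : ℝ) else 0) else 0) / ((n : ℝ) + 1) := by
        intro t
        split_ifs <;> simp
      simp only [h2]
      rw [← Finset.sum_div, Finset.sum_comm]
      simp only [Finset.sum_ite_eq, Finset.mem_univ, if_true, map_intCast]

/-- Two almost sure events of a probability measure share a configuration, and its single limit
represents both classes. -/
theorem IsEmpiricalLimit.cyclicEquiv {r : ℕ} [NeZero r] {nu : Measure (G.Dart → ℤ)}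
    [IsProbabilityMeasure nu] {x : InfinitePath G} {m : ℕ} {h : ℤ} {α β : ZMod r → ℝ}
    (hα : IsEmpiricalLimit nu x m h r α) (hβ : IsEmpiricalLimit nu x m h r β) :
    CyclicEquiv α β := by
  obtain ⟨η, ⟨a, ⟨s, hs⟩, ha⟩, b, ⟨s', hs'⟩, hb⟩ := (hα.2.and hβ.2).exists
  obtain rfl := tendsto_nhds_unique ha hb
  refine ⟨s' - s, fun k => ?_⟩
  have h1 := hs (k - s)
  rw [hs', sub_add_cancel] at h1
  rw [← h1]
  congr 1
  ring

/-! ### Periods -/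

theorem IsMinimalPeriod.dvd {f : ℤ → ℝ} {p r : ℕ} (hp : IsMinimalPeriod f p)
    (hr : Function.Periodic f (r : ℤ)) : p ∣ r := by
  by_contra h
  have hpos : 0 < r % p := Nat.pos_of_ne_zero fun h0 => h (Nat.dvd_of_mod_eq_zero h0)
  have hlt := Nat.mod_lt r hp.1.1
  refine absurd (hp.2 ⟨hpos, ?_⟩) (by omega)
  have h1 := hr.sub_period (hp.1.2.int_mul (r / p : ℕ))
  have h2 : (r : ℤ) - (r / p : ℕ) * (p : ℤ) = ((r % p : ℕ) : ℤ) := by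
    have := Nat.div_add_mod r p
    have h3 : ((p * (r / p) + r % p : ℕ) : ℤ) = r := by rw [this]
    push_cast at h3 ⊢
    linarith
  intro i
  have := h1 i
  simp only [Int.cast_natCast] at this
  rwa [h2] at this

theorem exists_shiftScaled_of_periodic {q r : ℕ} [NeZero r] {lam : ZMod q → ℝ}
    (h : Function.Periodic (fun i : ℤ => lam (i : ZMod q)) (r : ℤ)) :
    ∃ mu : ZMod r → ℝ, ShiftScaled lam mu 1 0 := by
  refine ⟨fun k => lam ((k.val : ℤ) : ZMod q), fun i => ?_⟩
  have h1 := h.int_mul (i / r) (i % r)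
  simp only [Int.cast_id] at h1
  rw [add_comm, mul_comm, Int.mul_ediv_add_emod] at h1
  beta_reduce
  rw [ZMod.val_intCast, one_mul, add_zero, h1]

theorem shiftScaled_castHom {q N : ℕ} (h : q ∣ N) (lam : ZMod q → ℝ) :
    ShiftScaled lam (fun t : ZMod N => lam (ZMod.castHom h (ZMod q) t)) 1 0 := fun i => by
  simp

/-- The tentative boundary law recovers the boundary law from the stationary distribution, up to a
shift and a factor. -/
theorem tentative_shiftScaled {d r : ℕ} [NeZero r] (hd : d ≠ 0) {mu α : ZMod r → ℝ}
    (hmu : ∀ i, 0 < mu i) (h : CyclicEquiv α (fuzzyAlpha d r mu)) :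
    ∃ K : ℝ, 0 < K ∧ ∃ a : ℤ, ShiftScaled mu (tentative d α) K a := by
  obtain ⟨s, hs⟩ := h
  obtain ⟨a, rfl⟩ := ZMod.intCast_surjective s
  have hZ := sum_rpow_pos hmu (((d : ℝ) + 1) / d)
  -- The exponents `(d + 1) / d` and `d / (d + 1)` cancel, so only the power of the normaliser
  -- remains as a factor.
  refine ⟨((∑ s, mu s ^ (((d : ℝ) + 1) / d)) ^ ((d : ℝ) / ((d : ℝ) + 1)))⁻¹,
    inv_pos.2 (Real.rpow_pos_of_pos hZ _), a, fun i => ?_⟩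
  have hd' : (d : ℝ) ≠ 0 := by exact_mod_cast hd
  have hd1 : (d : ℝ) + 1 ≠ 0 := by positivity
  rw [tentative, hs, fuzzyAlpha, Real.div_rpow (Real.rpow_pos_of_pos (hmu _) _).le hZ.le,
    ← Real.rpow_mul (hmu _).le, div_mul_div_cancel₀ hd', div_self hd1, Real.rpow_one,
    Int.cast_add, div_eq_inv_mul]

section Period

variable {d q r : ℕ} [NeZero q] [NeZero r] {Q : ℤ → ℝ} {lam : ZMod q → ℝ} {mu : ZMod r → ℝ}

/-- Two periodic boundary laws with the same gradient measure have the same periods. -/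
theorem periodic_of_isGGM [Countable V] (hT : G.IsTree) (hd : d ≠ 0)
    (hQ : IsTransferOperator Q) (hlam : IsPeriodicBoundaryLaw d Q q lam)
    (hmu : IsPeriodicBoundaryLaw d Q r mu) {nu : Measure (G.Dart → ℤ)}
    (hnu : IsGGM G d Q q lam nu) (hnu' : IsGGM G d Q r mu nu) (x : InfinitePath G) :
    Function.Periodic (fun i : ℤ => lam (i : ZMod q)) (r : ℤ) := by
  have := hnu.prob
  have hl := shiftScaled_castHom (dvd_mul_right q r) lam
  have hm := shiftScaled_castHom (dvd_mul_left r q) mu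
  have e1 := isEmpiricalLimit_fuzzyAlpha hT hd hQ (hlam.shiftScaled one_pos hl)
    (hnu.shiftScaled hT hQ hl one_pos hlam.pos) x 0 0
  have e2 := isEmpiricalLimit_fuzzyAlpha hT hd hQ (hmu.shiftScaled one_pos hm)
    (hnu'.shiftScaled hT hQ hm one_pos hmu.pos) x 0 0
  obtain ⟨s, hs⟩ := e1.cyclicEquiv e2
  obtain ⟨a, rfl⟩ := ZMod.intCast_surjective s
  intro i
  -- Up to a cyclic shift this distribution is the one of `mu`, which visibly has period `r`;
  -- injectivity of the positive power then passes the period to `lam`.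
  have h1 : fuzzyAlpha d (q * r) (fun t => lam (ZMod.castHom (dvd_mul_right q r) (ZMod q) t))
      ((i + r : ℤ) : ZMod (q * r)) =
      fuzzyAlpha d (q * r) (fun t => lam (ZMod.castHom (dvd_mul_right q r) (ZMod q) t))
      (i : ZMod (q * r)) := by
    rw [hs, hs]
    simp [fuzzyAlpha]
  unfold fuzzyAlpha at h1
  rw [div_left_inj' (sum_rpow_pos (fun t => hlam.pos _) _).ne'] at h1
  simp only [map_intCast] at h1
  have hd0 : (0 : ℝ) < d := by exact_mod_cast Nat.pos_of_ne_zero hd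
  exact (Real.rpow_left_inj (hlam.pos _).le (hlam.pos _).le (by positivity)).1 h1

end Period

end Tree

end PeriodicGGM

end

/-! ### Assembly: deterministic limits and the minimal period as greatest common divisor -/

theorem corollary3p7 {V : Type*} (G : SimpleGraph V) [G.LocallyFinite] (d : ℕ) (hd : 2 ≤ d)
    (hT : G.IsTree) (hreg : G.IsRegularOfDegree (d + 1))
    (Q : ℤ → ℝ) (hQ : PeriodicGGM.IsTransferOperator Q)
    (q : ℕ) [NeZero q] (hq : 2 ≤ q) (lam : ZMod q → ℝ)
    (hlam : PeriodicGGM.IsPeriodicBoundaryLaw d Q q lam)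
    (p : ℕ) (hp : PeriodicGGM.IsMinimalPeriod (fun i : ℤ => lam (i : ZMod q)) p) :
    -- the gradient measure of `lam` is well defined
    ∃ nu : Measure (G.Dart → ℤ), PeriodicGGM.IsGGM G d Q q lam nu ∧
      (∀ nu' : Measure (G.Dart → ℤ), PeriodicGGM.IsGGM G d Q q lam nu' → nu' = nu) ∧
      -- the empirical distributions converge to a deterministic limit
      (∀ (r : ℕ) [NeZero r], 2 ≤ r → ∃ alpha : ZMod r → ℝ,
        ∀ (x : PeriodicGGM.InfinitePath G) (m : ℕ) (h : ℤ),
          PeriodicGGM.IsEmpiricalLimit nu x m h r alpha) ∧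
      -- the minimal period is the greatest common divisor
      ∀ (x : PeriodicGGM.InfinitePath G) (m : ℕ) (h : ℤ) (alpha : (r : ℕ) → ZMod r → ℝ),
        (∀ (r : ℕ) [NeZero r], 2 ≤ r → PeriodicGGM.IsEmpiricalLimit nu x m h r (alpha r)) →
        PeriodicGGM.IsGCD
          {r : ℕ | ∃ _ : NeZero r, 2 ≤ r ∧
            PeriodicGGM.IsPeriodicBoundaryLaw d Q r (PeriodicGGM.tentative d (alpha r)) ∧
            PeriodicGGM.IsGGM G d Q r (PeriodicGGM.tentative d (alpha r)) nu}
          p := by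
  have hd0 : d ≠ 0 := by omega
  have hV : Countable V := PeriodicGGM.countable_of_connected_locallyFinite hT.connected
  have hstep := PeriodicGGM.isProbabilityMeasure_stepLaw hQ hlam.pos
  obtain ⟨o⟩ := hT.connected.nonempty
  have hnu := PeriodicGGM.isGGM_rootedGGM hT hd0 hQ hlam o
  set nu := PeriodicGGM.rootedGGM G d Q lam o
  have hprob := hnu.prob
  refine ⟨nu, hnu, fun nu' hnu' => hnu'.unique hT hQ hnu, fun r _ _ => ?_,
    fun x m h alpha halpha => ?_⟩
  -- Heights modulo `r` alone need not form a Markov chain, but modulo `q * r` they do; the limit is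
  -- then projected.
  · have hl := PeriodicGGM.shiftScaled_castHom (dvd_mul_right q r) lam
    exact ⟨_, fun x m h => (PeriodicGGM.isEmpiricalLimit_fuzzyAlpha hT hd0 hQ
      (hlam.shiftScaled one_pos hl) (hnu.shiftScaled hT hQ hl one_pos hlam.pos) x m h).castHom
      (dvd_mul_left r q)⟩
  · have hmem : ∀ k : ℕ, 2 ≤ p * k → p * k ∈ {r : ℕ | ∃ _ : NeZero r, 2 ≤ r ∧
        PeriodicGGM.IsPeriodicBoundaryLaw d Q r (PeriodicGGM.tentative d (alpha r)) ∧
        PeriodicGGM.IsGGM G d Q r (PeriodicGGM.tentative d (alpha r)) nu} := by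
      intro k hk
      have hne : NeZero (p * k) := ⟨by omega⟩
      have hper : Function.Periodic (fun i : ℤ => lam (i : ZMod q)) ((p * k : ℕ) : ℤ) := by
        have := hp.1.2.int_mul k
        rwa [Int.cast_natCast, mul_comm, ← Nat.cast_mul] at this
      obtain ⟨mu, hmu⟩ := PeriodicGGM.exists_shiftScaled_of_periodic hper
      have hbl := hlam.shiftScaled one_pos hmu
      have hg := hnu.shiftScaled hT hQ hmu one_pos hlam.pos
      obtain ⟨K, hK, a, ha⟩ := PeriodicGGM.tentative_shiftScaled hd0 hbl.pos
        ((halpha (p * k) hk).cyclicEquiv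
          (PeriodicGGM.isEmpiricalLimit_fuzzyAlpha hT hd0 hQ hbl hg x m h))
      exact ⟨hne, hk, hbl.shiftScaled hK ha, hg.shiftScaled hT hQ ha hK hbl.pos⟩
    have hp0 : 0 < p := hp.1.1
    refine ⟨?_, fun n hn => ?_⟩
    · rintro r ⟨_, -, hbl, hg⟩
      exact hp.dvd (PeriodicGGM.periodic_of_isGGM hT hd0 hQ hlam hbl hnu hg x)
    -- For `p = 1` the number `p` itself is not admissible, so it is obtained as the difference of
    -- `3 * p` and `2 * p`.
    · have h2 := hn _ (hmem 2 (by omega))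
      have h3 := hn _ (hmem 3 (by omega))
      have h1 : n ∣ p := by
        have := Nat.dvd_sub h3 h2
        simpa [← Nat.mul_sub] using this
      exact Nat.le_of_dvd hp0 h1
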